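/- Let $n,p\in\mathbb{N}$ and let $q_\gamma\in\mathbb{N}$ for each $\gamma\in\mathbb{Z}_2^n\setminus\{0\}$. A degree $\gamma\in\mathbb{Z}_2^n$ is called odd (even) if the sum of its components is $1$ ($0$) in $\mathbb{Z}_2$, and $\langle-,-\rangle$ is the standard scalar product of $\mathbb{Z}_2^n$. The domain $\mathbb{R}^{p|\mathbf q}$ is $\mathbb{R}^p$ with the sheaf $V\mapsto C^\infty(V)[[\xi]]$ of formal power series in formal coordinates $\xi^a$, of which $q_\gamma$ have degree $\gamma$, subject to $\xi^a\xi^b=(-1)^{\langle\deg\xi^a,\deg\xi^b\rangle}\xi^b\xi^a$. Let $\mathcal{M}=(M,\mathcal{O}_M)$ be a $\mathbb{Z}_2^n$-manifold of dimension $p|\mathbf q$: a second-countable Hausdorff space $M$ with a sheaf $\mathcal{O}_M$ of $\mathbb{Z}_2^n$-graded $\mathbb{Z}_2^n$-commutative associative unital $\mathbb{R}$-algebras whose stalks are local graded rings, locally isomorphic to $\mathbb{R}^{p|\mathbf q}$. For $U\subset M$ open, let $\mathcal{D}^{-1}(U)=\{0\}$ and, for $k\in\mathbb{N}$, $$\mathcal{D}^k(U)=\{D\in\operatorname{End}_{\mathbb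 R}(\mathcal{O}_M(U)) : [D,f]\in\mathcal{D}^{k-1}(U)\ \text{for all } f\in\mathcal{O}_M(U)\},$$ where all $\mathbb{R}$-linear endomorphisms are allowed, $f$ is identified with the multiplication by $f$, and $[-,-]$ is the graded commutator, the bilinear extension of $[D,E]=DE-(-1)^{\langle\deg D,\deg E\rangle}ED$. Theorem. Let $k\in\mathbb{N}$. Every $\mathcal{D}^k(U)$ is a $\mathbb{Z}_2^n$-graded $\mathcal{O}_M(U)$-module. There is exactly one way to make $U\mapsto\mathcal{D}^k(U)$ a presheaf of $\mathbb{Z}_2^n$-graded $\mathcal{O}_M$-modules with restrictions that satisfy $(D|_V)(g|_V)=(Dg)|_V$ for all open $V\subset U$, $D\in\mathcal{D}^k(U)$ and $g\in\mathcal{O}_M(U)$. This presheaf $\mathcal{D}^k_M$ is a sheaf, and it is a locally free sheaf of $\mathbb{Z}_2^n$-graded $\mathcal{O}_M$-modules (of finite rank). More precisely, let $(x,\theta,\zeta)$ be coordinates on an open $U\subset M$, given by an isomorphism of $(U,\mathcal{O}_M|_U)$ with an open subspace of $\mathbb{R}^{p|\mathbf q}$, where $x$, $\theta$, $\zeta$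 are the coordinates of degree zero, of non-zero even degree and of odd degree. Then the operators $$\partial_\zeta^\gamma\,\partial_\theta^\beta\,\partial_x^\alpha,\qquad \alpha^c,\beta^b\in\mathbb{N},\ \gamma^a\in\{0,1\},\ |\alpha|+|\beta|+|\gamma|\le k,$$ where $\partial_x$, $\partial_\theta$, $\partial_\zeta$ are the graded partial derivatives, composed in decreasing order of the coordinates, are homogeneous elements of $\mathcal{D}^k(U)$ of degree $\sum_b\beta^b\deg\theta^b+\sum_a\gamma^a\deg\zeta^a$. For every open $W\subset U$ their restrictions to $W$ are the corresponding operators of the coordinates restricted to $W$, and they form a basis of the left $\mathcal{O}_M(W)$-module $\mathcal{D}^k(W)$. (The coordinates are ordered with $x$ first, then the even degrees in lexicographic order, then the odd degrees in lexicographic order.) -/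

import Mathlib

open CategoryTheory TopologicalSpace Opposite
open scoped Manifold ContDiff

set_option linter.unusedSectionVars false

universe u

noncomputable section

namespace Z2n

/-! ### Degrees and signs -/

/-- The grading group `ℤ₂ⁿ`. -/
abbrev Deg (n : ℕ) : Type := Fin n → ZMod 2

/-- The sign `(-1)^⟨γ, δ⟩`, where `⟨-,-⟩` is the standard scalar product of `ℤ₂ⁿ`. -/
def sgn {n : ℕ} (γ δ : Deg n) : ℝ := (-1) ^ (∑ i, γ i * δ i).val

/-- The total parity of a degree. -/
def parity {n : ℕ} (γ : Deg n) : ZMod 2 := ∑ i, γ i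

/-- A degree is odd if its components sum up to `1`. -/
def IsOdd {n : ℕ} (γ : Deg n) : Prop := parity γ = 1

theorem sgn_add_left {n : ℕ} (γ γ' δ : Deg n) : sgn (γ + γ') δ = sgn γ δ * sgn γ' δ := by
  have key : ∀ a b : ZMod 2, ((-1 : ℝ)) ^ (a + b).val = (-1) ^ a.val * (-1) ^ b.val := by
    intro a b
    rw [← pow_add, ZMod.val_add, ← neg_one_pow_eq_pow_mod_two]
  simp only [sgn, Pi.add_apply, add_mul, Finset.sum_add_distrib, key]

theorem sgn_comm {n : ℕ} (γ δ : Deg n) : sgn γ δ = sgn δ γ := by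
  simp only [sgn, mul_comm]

theorem sgn_add_right {n : ℕ} (γ δ δ' : Deg n) : sgn γ (δ + δ') = sgn γ δ * sgn γ δ' := by
  rw [sgn_comm, sgn_add_left, sgn_comm δ, sgn_comm δ']

/-! ### Formal power series in `ℤ₂ⁿ`-commuting variables -/

section Series

variable {n : ℕ} {ι : Type} [Fintype ι] [LinearOrder ι]

/-- Exponents of monomials: an odd variable squares to zero, so its exponent is `0` or `1`. -/
def Admissible (d : ι → Deg n) (α : ι →₀ ℕ) : Prop := ∀ a, IsOdd (d a) → α a ≤ 1

/-- Multi-indices: arbitrary exponents for the even variables, exponents in `{0, 1}` for the odd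
ones. -/
abbrev MultiIdx (d : ι → Deg n) : Type := {α : ι →₀ ℕ // Admissible d α}

/-- The degree `∑ α_a deg ξ_a` of the monomial `ξ^α`. -/
def monDeg (d : ι → Deg n) (α : ι →₀ ℕ) : Deg n := ∑ a, α a • d a

/-- The sign in `ξ^α ξ^β = ± ξ^(α+β)`, where `ξ^α` is the product of the `ξ_a^(α_a)` in increasing
order of `a`. -/
def cocycle (d : ι → Deg n) (α β : ι →₀ ℕ) : ℝ :=
  ∏ a, ∏ b, if b < a then sgn (d a) (d b) ^ (α a * β b) else 1

/-- Formal power series `∑_α f_α ξ^α` in `ℤ₂ⁿ`-commuting variables `ξ_a` of degrees `d a`, with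
coefficients `f_α` in a commutative algebra `R` of degree zero. -/
def Series (d : ι → Deg n) (R : Type) : Type := MultiIdx d → R

namespace Series

variable {d : ι → Deg n} {R : Type} [CommRing R] [Algebra ℝ R]

instance : AddCommGroup (Series d R) := inferInstanceAs (AddCommGroup (MultiIdx d → R))

instance : Module ℝ (Series d R) := inferInstanceAs (Module ℝ (MultiIdx d → R))

open Classical in
/-- The coefficient of `ξ^α`, which is zero if `α` is not an admissible exponent. -/
def coeff (α : ι →₀ ℕ) (f : Series d R) : R := if h : Admissible d α then f ⟨α, h⟩ else 0

/-- The product determined by `ξ^α ξ^β = ± ξ^(α+β)`. -/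
instance : Mul (Series d R) where
  mul f g := fun γ => ∑ p ∈ Finset.HasAntidiagonal.antidiagonal γ.1,
    cocycle d p.1 p.2 • (coeff p.1 f * coeff p.2 g)

instance : One (Series d R) where
  one := fun γ => if γ.1 = 0 then 1 else 0

@[ext]
theorem ext {f g : Series d R} (h : ∀ α, Admissible d α → coeff α f = coeff α g) : f = g := by
  funext α
  have := h α.1 α.2
  simpa [coeff, α.2] using this

theorem coeff_add (α : ι →₀ ℕ) (f g : Series d R) : coeff α (f + g) = coeff α f + coeff α g := by
  by_cases h : Admissible d α
  · simp only [coeff, h, dite_true]; rfl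
  · simp [coeff, h]

theorem coeff_smul (α : ι →₀ ℕ) (r : ℝ) (f : Series d R) : coeff α (r • f) = r • coeff α f := by
  by_cases h : Admissible d α
  · simp only [coeff, h, dite_true]; rfl
  · simp [coeff, h]

theorem coeff_zero (α : ι →₀ ℕ) : coeff α (0 : Series d R) = 0 := by
  by_cases h : Admissible d α
  · simp only [coeff, h, dite_true]; rfl
  · simp [coeff, h]

theorem coeff_mul {α : ι →₀ ℕ} (h : Admissible d α) (f g : Series d R) :
    coeff α (f * g) = ∑ p ∈ Finset.HasAntidiagonal.antidiagonal α,
      cocycle d p.1 p.2 • (coeff p.1 f * coeff p.2 g) := by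
  simp only [coeff, h, dite_true]; rfl

theorem coeff_one (α : ι →₀ ℕ) : coeff α (1 : Series d R) = if α = 0 then 1 else 0 := by
  by_cases h : Admissible d α
  · simp only [coeff, h, dite_true]; rfl
  · have : α ≠ 0 := by rintro rfl; exact h (fun a _ => by simp)
    simp [coeff, h, this]

theorem cocycle_zero_left (β : ι →₀ ℕ) : cocycle d 0 β = 1 := by simp [cocycle]

theorem cocycle_zero_right (α : ι →₀ ℕ) : cocycle d α 0 = 1 := by simp [cocycle]

theorem cocycle_add_left (α α' β : ι →₀ ℕ) :
    cocycle d (α + α') β = cocycle d α β * cocycle d α' β := by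
  simp only [cocycle, ← Finset.prod_mul_distrib]
  refine Finset.prod_congr rfl fun a _ => Finset.prod_congr rfl fun b _ => ?_
  split_ifs
  · rw [Finsupp.add_apply, add_mul, pow_add]
  · simp

theorem cocycle_add_right (α β β' : ι →₀ ℕ) :
    cocycle d α (β + β') = cocycle d α β * cocycle d α β' := by
  simp only [cocycle, ← Finset.prod_mul_distrib]
  refine Finset.prod_congr rfl fun a _ => Finset.prod_congr rfl fun b _ => ?_
  split_ifs
  · rw [Finsupp.add_apply, mul_add, pow_add]
  · simp

theorem Admissible.of_add_left {α β : ι →₀ ℕ} (h : Admissible d (α + β)) : Admissible d α :=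
  fun a ha => le_trans (by simp) (h a ha)

theorem Admissible.of_add_right {α β : ι →₀ ℕ} (h : Admissible d (α + β)) : Admissible d β :=
  fun a ha => le_trans (by simp) (h a ha)

protected theorem one_mul (f : Series d R) : 1 * f = f := by
  ext α h
  rw [coeff_mul h, Finset.sum_eq_single (0, α)]
  · simp [coeff_one, cocycle_zero_left]
  · rintro ⟨a, b⟩ hab hne
    have : a ≠ 0 := by
      rintro rfl
      simp only [Finset.HasAntidiagonal.mem_antidiagonal, zero_add] at hab
      exact hne (by rw [hab])
    simp [coeff_one, this]
  · simp

protected theorem mul_one (f : Series d R) : f * 1 = f := by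
  ext α h
  rw [coeff_mul h, Finset.sum_eq_single (α, 0)]
  · simp [coeff_one, cocycle_zero_right]
  · rintro ⟨a, b⟩ hab hne
    have : b ≠ 0 := by
      rintro rfl
      simp only [Finset.HasAntidiagonal.mem_antidiagonal, add_zero] at hab
      exact hne (by rw [hab])
    simp [coeff_one, this]
  · simp

protected theorem mul_assoc (f g k : Series d R) : f * g * k = f * (g * k) := by
  ext α h
  rw [coeff_mul h, coeff_mul h]
  have e1 : ∀ p ∈ Finset.HasAntidiagonal.antidiagonal α,
      cocycle d p.1 p.2 • (coeff p.1 (f * g) * coeff p.2 k) =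
      ∑ s ∈ Finset.HasAntidiagonal.antidiagonal p.1, (cocycle d s.1 s.2 * cocycle d s.1 p.2 * cocycle d s.2 p.2) •
        (coeff s.1 f * coeff s.2 g * coeff p.2 k) := by
    intro p hp
    rw [Finset.HasAntidiagonal.mem_antidiagonal] at hp
    subst hp
    rw [coeff_mul (Admissible.of_add_left h), Finset.sum_mul, Finset.smul_sum]
    refine Finset.sum_congr rfl fun s hs => ?_
    rw [Finset.HasAntidiagonal.mem_antidiagonal] at hs
    rw [← hs, cocycle_add_left, smul_mul_assoc, smul_smul]
    congr 1
    ring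
  have e2 : ∀ p ∈ Finset.HasAntidiagonal.antidiagonal α,
      cocycle d p.1 p.2 • (coeff p.1 f * coeff p.2 (g * k)) =
      ∑ s ∈ Finset.HasAntidiagonal.antidiagonal p.2, (cocycle d p.1 s.1 * cocycle d p.1 s.2 * cocycle d s.1 s.2) •
        (coeff p.1 f * coeff s.1 g * coeff s.2 k) := by
    intro p hp
    rw [Finset.HasAntidiagonal.mem_antidiagonal] at hp
    subst hp
    rw [coeff_mul (Admissible.of_add_right h), Finset.mul_sum, Finset.smul_sum]
    refine Finset.sum_congr rfl fun s hs => ?_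
    rw [Finset.HasAntidiagonal.mem_antidiagonal] at hs
    rw [← hs, cocycle_add_right, mul_smul_comm, smul_smul, mul_assoc (coeff p.1 f)]
  rw [Finset.sum_congr rfl e1, Finset.sum_congr rfl e2]
  simp only [Finset.sum_sigma']
  refine Finset.sum_nbij' (fun x => ⟨(x.2.1, x.2.2 + x.1.2), (x.2.2, x.1.2)⟩)
    (fun x => ⟨(x.1.1 + x.2.1, x.2.2), (x.1.1, x.2.1)⟩) ?_ ?_ ?_ ?_ ?_
  · rintro ⟨⟨a, b⟩, ⟨s, t⟩⟩ hx
    simp only [Finset.mem_sigma, Finset.HasAntidiagonal.mem_antidiagonal] at hx ⊢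
    obtain ⟨rfl, rfl⟩ := hx
    exact ⟨by rw [add_assoc], trivial⟩
  · rintro ⟨⟨a, b⟩, ⟨s, t⟩⟩ hx
    simp only [Finset.mem_sigma, Finset.HasAntidiagonal.mem_antidiagonal] at hx ⊢
    obtain ⟨rfl, rfl⟩ := hx
    exact ⟨by rw [add_assoc], trivial⟩
  · rintro ⟨⟨a, b⟩, ⟨s, t⟩⟩ hx
    simp only [Finset.mem_sigma, Finset.HasAntidiagonal.mem_antidiagonal] at hx
    obtain ⟨rfl, rfl⟩ := hx
    rfl
  · rintro ⟨⟨a, b⟩, ⟨s, t⟩⟩ hx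
    simp only [Finset.mem_sigma, Finset.HasAntidiagonal.mem_antidiagonal] at hx
    obtain ⟨rfl, rfl⟩ := hx
    rfl
  · rintro ⟨⟨a, b⟩, ⟨s, t⟩⟩ hx
    rfl

instance : Ring (Series d R) where
  __ := (inferInstance : AddCommGroup (Series d R))
  zero_mul f := by
    ext α h
    simp [coeff_mul h, coeff_zero]
  mul_zero f := by
    ext α h
    simp [coeff_mul h, coeff_zero]
  left_distrib f g k := by
    ext α h
    simp only [coeff_mul h, coeff_add, mul_add, smul_add, Finset.sum_add_distrib]
  right_distrib f g k := by
    ext α h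
    simp only [coeff_mul h, coeff_add, add_mul, smul_add, Finset.sum_add_distrib]
  one_mul := Series.one_mul
  mul_one := Series.mul_one
  mul_assoc := Series.mul_assoc

instance : Algebra ℝ (Series d R) :=
  Algebra.ofModule
    (fun r f g => by
      ext α h
      simp only [coeff_mul h, coeff_smul, smul_mul_assoc, Finset.smul_sum, smul_comm r])
    (fun r f g => by
      ext α h
      simp only [coeff_mul h, coeff_smul, mul_smul_comm, Finset.smul_sum, smul_comm r])

/-- The homogeneous part of degree `γ`: the series in the monomials of degree `γ`. -/
def homogeneous (γ : Deg n) : Submodule ℝ (Series d R) where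
  carrier := {f | ∀ α, monDeg d α ≠ γ → coeff α f = 0}
  add_mem' hf hg α hα := by rw [coeff_add, hf α hα, hg α hα, add_zero]
  zero_mem' α _ := coeff_zero α
  smul_mem' r f hf α hα := by rw [coeff_smul, hf α hα, smul_zero]

/-- Apply a linear map to all coefficients. -/
def mapCoeff {S : Type} [CommRing S] [Algebra ℝ S] (φ : R →ₗ[ℝ] S) :
    Series d R →ₗ[ℝ] Series d S where
  toFun f := fun α => φ (f α)
  map_add' f g := funext fun α => map_add φ (f α) (g α)
  map_smul' r f := funext fun α => map_smul φ r (f α)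

/-- The graded (left) partial derivative with respect to the variable `ξ_a`: on monomials,
`∂_a ξ^μ = (∏_{b < a} (-1)^(⟨deg ξ_a, deg ξ_b⟩ μ_b)) μ_a ξ^(μ - e_a)`. -/
def formalDeriv (a : ι) : Series d R →ₗ[ℝ] Series d R where
  toFun f := fun α => ((∏ b, if b < a then sgn (d a) (d b) ^ α.1 b else 1) * (α.1 a + 1 : ℝ)) •
    coeff (α.1 + Finsupp.single a 1) f
  map_add' f g := funext fun α => by
    rw [coeff_add, smul_add]; rfl
  map_smul' r f := funext fun α => by
    rw [coeff_smul, smul_comm]; rfl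

end Series

end Series

/-! ### The domain `ℝ^{p|q}` -/

/-- The formal coordinates of a domain with `q γ` coordinates of each non-zero degree `γ`. -/
def FormalVar {n : ℕ} (q : {γ : Deg n // γ ≠ 0} → ℕ) : Type := Σ γ, Fin (q γ)

namespace FormalVar

variable {n : ℕ} {q : {γ : Deg n // γ ≠ 0} → ℕ}

instance : Fintype (FormalVar q) := by
  classical exact inferInstanceAs (Fintype (Σ γ, Fin (q γ)))

/-- The degree of a formal coordinate. -/
def deg (a : FormalVar q) : Deg n := a.1.1

/-- The key for the standard order of coordinates: first the even degrees in lexicographic order,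
then the odd degrees in lexicographic order; coordinates of the same degree are ordered by their
number. -/
def key (a : FormalVar q) : ℕ ×ₗ (Lex (Fin n → ℕ)) ×ₗ ℕ :=
  toLex ((parity a.deg).val, toLex (toLex (fun i => (a.deg i).val), a.2.val))

theorem key_injective : Function.Injective (key (q := q)) := by
  rintro ⟨⟨γ, hγ⟩, i⟩ ⟨⟨δ, hδ⟩, j⟩ h
  simp only [key, deg, EmbeddingLike.apply_eq_iff_eq, Prod.mk.injEq] at h
  obtain ⟨-, h1, h2⟩ := h
  have : γ = δ := funext fun k => ZMod.val_injective 2 (congrFun h1 k)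
  subst this
  have : i = j := Fin.ext h2
  subst this
  rfl

instance : LinearOrder (FormalVar q) := LinearOrder.lift' key key_injective

end FormalVar

/-- The degree zero coordinate space. -/
abbrev Base (p : ℕ) : Type := EuclideanSpace ℝ (Fin p)

/-- Smooth functions on an open subset of `ℝ^p`. -/
abbrev Smooth {p : ℕ} (V : Opens (Base p)) : Type := C^∞⟮𝓘(ℝ, Base p), V; 𝓘(ℝ, ℝ), ℝ⟯

/-- The sections `C^∞(V)[[ξ]]` of the structure sheaf of `ℝ^{p|q}` over `V`. -/
abbrev DomainSections {n p : ℕ} (q : {γ : Deg n // γ ≠ 0} → ℕ) (V : Opens (Base p)) : Type :=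
  Series (FormalVar.deg (q := q)) (Smooth V)

/-- The restriction of smooth functions. -/
def smoothRes {p : ℕ} {V W : Opens (Base p)} (h : W ≤ V) : Smooth V →ₗ[ℝ] Smooth W where
  toFun f := ContMDiffMap.restrictRingHom 𝓘(ℝ, Base p) 𝓘(ℝ, ℝ) ℝ h f
  map_add' f g := map_add _ f g
  map_smul' _ _ := rfl

/-- The restriction in the structure sheaf of `ℝ^{p|q}`. -/
def domainRes {n p : ℕ} (q : {γ : Deg n // γ ≠ 0} → ℕ) {V W : Opens (Base p)} (h : W ≤ V) :
    DomainSections q V →ₗ[ℝ] DomainSections q W :=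
  Series.mapCoeff (smoothRes h)

open Classical in
/-- Extension by zero of a function on an open subset. -/
def extendZero {p : ℕ} {V : Opens (Base p)} (f : V → ℝ) (x : Base p) : ℝ :=
  if h : x ∈ V then f ⟨x, h⟩ else 0

theorem extendZero_coe {p : ℕ} {V : Opens (Base p)} (f : V → ℝ) (x : V) :
    extendZero f x = f x := by
  simp [extendZero]

theorem contDiffAt_extendZero {p : ℕ} {V : Opens (Base p)} (f : Smooth V) (x : V) :
    ContDiffAt ℝ ∞ (extendZero f) (x : Base p) := by
  have h : ContMDiffAt 𝓘(ℝ, Base p) 𝓘(ℝ, ℝ) ∞ (fun y : V => extendZero f (y : Base p)) x := by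
    have : (fun y : V => extendZero f (y : Base p)) = f := funext fun y => extendZero_coe f y
    rw [this]
    exact f.contMDiff x
  exact (contMDiffAt_subtype_iff.mp h).contDiffAt

/-- The partial derivative `∂/∂x^i` of smooth functions on an open subset of `ℝ^p`. -/
def smoothDeriv {p : ℕ} {V : Opens (Base p)} (i : Fin p) : Smooth V →ₗ[ℝ] Smooth V where
  toFun f := ⟨fun x => fderiv ℝ (extendZero f) (x : Base p) (EuclideanSpace.single i 1), by
    intro x
    have h := ((contDiffAt_extendZero f x).fderiv_right (m := ∞) (by simp)).clm_apply
      (contDiffAt_const (c := (EuclideanSpace.single i 1 : Base p)))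
    exact contMDiffAt_subtype_iff.mpr h.contMDiffAt⟩
  map_add' f g := by
    ext x
    have e : extendZero (⇑(f + g)) = extendZero f + extendZero g := by
      funext y
      by_cases hy : y ∈ V <;> simp [extendZero, hy]
    change fderiv ℝ (extendZero (⇑(f + g))) (x : Base p) _ = fderiv ℝ (extendZero f) (x : Base p) _ +
      fderiv ℝ (extendZero g) (x : Base p) _
    rw [e, fderiv_add ((contDiffAt_extendZero f x).differentiableAt (by simp))
      ((contDiffAt_extendZero g x).differentiableAt (by simp))]
    rfl
  map_smul' r f := by
    ext x
    have e : extendZero (⇑(r • f)) = r • extendZero f := by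
      funext y
      by_cases hy : y ∈ V <;> simp [extendZero, hy]
    change fderiv ℝ (extendZero (⇑(r • f))) (x : Base p) _ =
      r • fderiv ℝ (extendZero f) (x : Base p) _
    rw [e, fderiv_const_smul ((contDiffAt_extendZero f x).differentiableAt (by simp))]
    rfl

/-- The exponents `(α, (β, γ))` with `|α| + |β| + |γ| ≤ k`, where `α` are the exponents for the
coordinates `x` of degree zero, `β` the exponents for the coordinates `θ` of non-zero even degree
and `γ` the exponents, all `0` or `1`, for the odd coordinates `ζ`; the pair `(β, γ)` is a
multi-index for the formal coordinates. -/
def DerivIdx {n : ℕ} (p : ℕ) (q : {γ : Deg n // γ ≠ 0} → ℕ) (k : ℕ) : Type :=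
  {i : (Fin p → ℕ) × MultiIdx (FormalVar.deg (q := q)) // ∑ c, i.1 c + ∑ a, i.2.1 a ≤ k}

/-- The degree of `∂_ζ^γ ∂_θ^β ∂_x^α`. -/
def DerivIdx.deg {n p k : ℕ} {q : {γ : Deg n // γ ≠ 0} → ℕ} (i : DerivIdx p q k) : Deg n :=
  monDeg FormalVar.deg i.1.2.1

/-- The operator `∂_ζ^γ ∂_θ^β ∂_x^α` on `C^∞(V)[[ξ]]`: the composition of the powers of the partial
derivatives in decreasing order of the coordinates (recall that in the increasing order the
coordinates of degree zero come first, followed by the even and finally by the odd ones). -/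
def domainDeriv {n p k : ℕ} {q : {γ : Deg n // γ ≠ 0} → ℕ} (V : Opens (Base p))
    (i : DerivIdx p q k) : Module.End ℝ (DomainSections q V) :=
  (((Finset.univ : Finset (FormalVar q)).sort (· ≥ ·)).map
      (fun a => (Series.formalDeriv a : Module.End ℝ (DomainSections q V)) ^ i.1.2.1 a)).prod *
    ((List.finRange p).reverse.map
      (fun c => (Series.mapCoeff (smoothDeriv c) : Module.End ℝ (DomainSections q V)) ^
        i.1.1 c)).prod

/-! ### Algebraic differential operators of a graded algebra -/

section DiffOp

variable {n : ℕ} {A : Type*} [Ring A] [Algebra ℝ A] (𝒜 : Deg n → Submodule ℝ A)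

/-- The `ℝ`-linear maps of degree `γ`. -/
def endHomogeneous (γ : Deg n) : Submodule ℝ (Module.End ℝ A) where
  carrier := {D | ∀ δ, ∀ a ∈ 𝒜 δ, D a ∈ 𝒜 (δ + γ)}
  add_mem' hD hE δ a ha := (𝒜 _).add_mem (hD δ a ha) (hE δ a ha)
  zero_mem' _ _ _ := (𝒜 _).zero_mem
  smul_mem' r _ hD δ a ha := (𝒜 _).smul_mem r (hD δ a ha)

variable [GradedAlgebra 𝒜]

/-- The component of degree `γ` of an `ℝ`-linear map. -/
def endComponent (γ : Deg n) (D : Module.End ℝ A) : Module.End ℝ A :=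
  ∑ δ, GradedAlgebra.proj 𝒜 (δ + γ) ∘ₗ D ∘ₗ GradedAlgebra.proj 𝒜 δ

/-- The graded commutator: the bilinear extension of `[D, E] = D E - (-1)^⟨deg D, deg E⟩ E D`. -/
def gradedCommutator (D E : Module.End ℝ A) : Module.End ℝ A :=
  ∑ γ, ∑ δ, (endComponent 𝒜 γ D * endComponent 𝒜 δ E -
    sgn γ δ • (endComponent 𝒜 δ E * endComponent 𝒜 γ D))

/-- Differential operators of order `k`, defined by induction: the graded commutator with the
multiplication by any element has order `k - 1`, the only operator of order `-1` being `0`. -/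
def IsDiffOp : ℕ → Module.End ℝ A → Prop
  | 0, D => ∀ f : A, gradedCommutator 𝒜 D (LinearMap.mulLeft ℝ f) = 0
  | k + 1, D => ∀ f : A, IsDiffOp k (gradedCommutator 𝒜 D (LinearMap.mulLeft ℝ f))

theorem endComponent_add (γ : Deg n) (D E : Module.End ℝ A) :
    endComponent 𝒜 γ (D + E) = endComponent 𝒜 γ D + endComponent 𝒜 γ E := by
  simp only [endComponent, LinearMap.add_comp, LinearMap.comp_add, Finset.sum_add_distrib]

theorem endComponent_apply (γ : Deg n) (D : Module.End ℝ A) (a : A) :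
    endComponent 𝒜 γ D a =
      ∑ δ, GradedAlgebra.proj 𝒜 (δ + γ) (D (GradedAlgebra.proj 𝒜 δ a)) := by
  simp [endComponent, LinearMap.sum_apply]

theorem gradedCommutator_add_left (D D' E : Module.End ℝ A) :
    gradedCommutator 𝒜 (D + D') E = gradedCommutator 𝒜 D E + gradedCommutator 𝒜 D' E := by
  simp only [gradedCommutator, endComponent_add, ← Finset.sum_add_distrib]
  refine Finset.sum_congr rfl fun γ _ => Finset.sum_congr rfl fun δ _ => ?_
  rw [add_mul, mul_add, smul_add]
  abel

theorem gradedCommutator_add_right (D E E' : Module.End ℝ A) :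
    gradedCommutator 𝒜 D (E + E') = gradedCommutator 𝒜 D E + gradedCommutator 𝒜 D E' := by
  simp only [gradedCommutator, endComponent_add, ← Finset.sum_add_distrib]
  refine Finset.sum_congr rfl fun γ _ => Finset.sum_congr rfl fun δ _ => ?_
  rw [add_mul, mul_add, smul_add]
  abel

theorem gradedCommutator_zero_left (E : Module.End ℝ A) : gradedCommutator 𝒜 0 E = 0 := by
  simpa using gradedCommutator_add_left 𝒜 0 0 E

theorem gradedCommutator_zero_right (D : Module.End ℝ A) : gradedCommutator 𝒜 D 0 = 0 := by
  simpa using gradedCommutator_add_right 𝒜 D 0 0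

theorem proj_mul_of_mem {φ : Deg n} {f : A} (hf : f ∈ 𝒜 φ) (γ : Deg n) (a : A) :
    GradedAlgebra.proj 𝒜 (φ + γ) (f * a) = f * GradedAlgebra.proj 𝒜 γ a := by
  simp only [GradedAlgebra.proj_apply]
  exact DirectSum.coe_decompose_mul_add_of_left_mem 𝒜 hf

/-- Multiplication by a homogeneous element shifts the degree. -/
theorem endComponent_smul {φ : Deg n} {f : A} (hf : f ∈ 𝒜 φ) (γ : Deg n) (D : Module.End ℝ A) :
    endComponent 𝒜 (φ + γ) (f • D) = f • endComponent 𝒜 γ D := by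
  ext a
  simp only [endComponent_apply, LinearMap.smul_apply, smul_eq_mul, Finset.mul_sum]
  refine Finset.sum_congr rfl fun δ _ => ?_
  rw [← proj_mul_of_mem 𝒜 hf, add_left_comm]

theorem sum_proj (a : A) : ∑ δ, GradedAlgebra.proj 𝒜 δ a = a := by
  classical
  simp only [GradedAlgebra.proj_apply]
  conv_rhs => rw [← DirectSum.sum_support_decompose 𝒜 a]
  symm
  apply Finset.sum_subset (Finset.subset_univ _)
  intro x _ hx
  simpa using hx

theorem sum_endComponent (D : Module.End ℝ A) : ∑ γ, endComponent 𝒜 γ D = D := by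
  ext a
  simp only [LinearMap.sum_apply, endComponent_apply]
  rw [Finset.sum_comm]
  have : ∀ δ, ∑ γ, GradedAlgebra.proj 𝒜 (δ + γ) (D (GradedAlgebra.proj 𝒜 δ a)) =
      D (GradedAlgebra.proj 𝒜 δ a) := by
    intro δ
    conv_rhs => rw [← sum_proj 𝒜 (D (GradedAlgebra.proj 𝒜 δ a))]
    exact Equiv.sum_comp (Equiv.addLeft δ)
      (fun x => GradedAlgebra.proj 𝒜 x (D (GradedAlgebra.proj 𝒜 δ a)))
  simp only [this, ← map_sum, sum_proj]

theorem endComponent_mulLeft {ψ : Deg n} {g : A} (hg : g ∈ 𝒜 ψ) (γ : Deg n) :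
    endComponent 𝒜 γ (LinearMap.mulLeft ℝ g) = if γ = ψ then LinearMap.mulLeft ℝ g else 0 := by
  ext a
  simp only [endComponent_apply, LinearMap.mulLeft_apply]
  have key : ∀ δ, GradedAlgebra.proj 𝒜 (δ + γ) (g * GradedAlgebra.proj 𝒜 δ a) =
      if γ = ψ then g * GradedAlgebra.proj 𝒜 δ a else 0 := by
    intro δ
    have hmem : g * GradedAlgebra.proj 𝒜 δ a ∈ 𝒜 (δ + ψ) := by
      rw [add_comm]
      exact SetLike.mul_mem_graded hg (by rw [GradedAlgebra.proj_apply]; exact SetLike.coe_mem _)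
    split_ifs with h
    · subst h
      rw [GradedAlgebra.proj_apply]
      exact DirectSum.decompose_of_mem_same 𝒜 hmem
    · rw [GradedAlgebra.proj_apply]
      exact DirectSum.decompose_of_mem_ne 𝒜 hmem (fun e => h (add_left_cancel e).symm)
  simp only [key]
  split_ifs
  · rw [← Finset.mul_sum, sum_proj, LinearMap.mulLeft_apply]
  · simp

theorem gradedCommutator_mulLeft {ψ : Deg n} {g : A} (hg : g ∈ 𝒜 ψ) (D : Module.End ℝ A) :
    gradedCommutator 𝒜 D (LinearMap.mulLeft ℝ g) =
      ∑ γ, (endComponent 𝒜 γ D * LinearMap.mulLeft ℝ g -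
        sgn γ ψ • (LinearMap.mulLeft ℝ g * endComponent 𝒜 γ D)) := by
  refine Finset.sum_congr rfl fun γ _ => ?_
  rw [Finset.sum_eq_single ψ]
  · simp [endComponent_mulLeft 𝒜 hg]
  · intro δ _ hδ
    simp [endComponent_mulLeft 𝒜 hg, hδ]
  · simp

/-- The `ℤ₂ⁿ`-commutation rule `a b = (-1)^⟨deg a, deg b⟩ b a`. -/
def GradedCommutative (𝒜 : Deg n → Submodule ℝ A) : Prop :=
  ∀ γ δ, ∀ a ∈ 𝒜 γ, ∀ b ∈ 𝒜 δ, a * b = sgn γ δ • (b * a)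

theorem sgn_mul_self (γ δ : Deg n) : sgn γ δ * sgn γ δ = 1 := by
  rw [sgn, ← mul_pow]; simp

variable {𝒜}

theorem gradedCommutator_smul (h𝒜 : GradedCommutative 𝒜) (f g : A) (D : Module.End ℝ A) :
    gradedCommutator 𝒜 (f • D) (LinearMap.mulLeft ℝ g) =
      f • gradedCommutator 𝒜 D (LinearMap.mulLeft ℝ g) := by
  have hom : ∀ φ ψ, ∀ f ∈ 𝒜 φ, ∀ g ∈ 𝒜 ψ,
      gradedCommutator 𝒜 (f • D) (LinearMap.mulLeft ℝ g) =
        f • gradedCommutator 𝒜 D (LinearMap.mulLeft ℝ g) := by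
    intro φ ψ f hf g hg
    rw [gradedCommutator_mulLeft 𝒜 hg, gradedCommutator_mulLeft 𝒜 hg, Finset.smul_sum,
      ← Equiv.sum_comp (Equiv.addLeft φ)]
    refine Finset.sum_congr rfl fun γ _ => ?_
    rw [Equiv.coe_addLeft, endComponent_smul 𝒜 hf]
    ext a
    simp only [LinearMap.sub_apply, LinearMap.smul_apply, Module.End.mul_apply,
      LinearMap.mulLeft_apply, smul_eq_mul, mul_sub]
    rw [← mul_assoc g f, h𝒜 ψ φ g hg f hf, smul_mul_assoc, smul_smul, sgn_add_left,
      sgn_comm ψ φ, mul_right_comm, sgn_mul_self, one_mul, mul_assoc, mul_smul_comm]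
  have hg : ∀ φ, ∀ f ∈ 𝒜 φ, ∀ g, gradedCommutator 𝒜 (f • D) (LinearMap.mulLeft ℝ g) =
        f • gradedCommutator 𝒜 D (LinearMap.mulLeft ℝ g) := by
    intro φ f hf g
    induction g using DirectSum.Decomposition.inductionOn 𝒜 with
    | zero => simp [gradedCommutator_zero_right]
    | homogeneous g => exact hom _ _ f hf _ g.2
    | add a b ha hb =>
      have e : LinearMap.mulLeft ℝ (a + b) = LinearMap.mulLeft ℝ a + LinearMap.mulLeft ℝ b := by
        ext; simp [add_mul]
      rw [e, gradedCommutator_add_right, gradedCommutator_add_right, ha, hb, smul_add]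
  induction f using DirectSum.Decomposition.inductionOn 𝒜 with
  | zero => simp [gradedCommutator_zero_left]
  | homogeneous f => exact hg _ _ f.2 g
  | add a b ha hb => rw [add_smul, gradedCommutator_add_left, ha, hb, add_smul]

/-- The `A`-module of differential operators of order `k`, a submodule of the `A`-module of all
`ℝ`-linear maps from `A` to itself (those are the sums of `ℝ`-linear maps of all degrees). -/
def diffOp (h𝒜 : GradedCommutative 𝒜) (k : ℕ) : Submodule A (Module.End ℝ A) where
  carrier := {D | IsDiffOp 𝒜 k D}
  add_mem' := by
    suffices h : ∀ D E, IsDiffOp 𝒜 k D → IsDiffOp 𝒜 k E → IsDiffOp 𝒜 k (D + E) from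
      fun {D E} hD hE => h D E hD hE
    induction k with
    | zero => intro D E hD hE f; rw [gradedCommutator_add_left, hD f, hE f, add_zero]
    | succ k ih =>
      intro D E hD hE f
      rw [gradedCommutator_add_left]
      exact ih _ _ (hD f) (hE f)
  zero_mem' := by
    change IsDiffOp 𝒜 k 0
    induction k with
    | zero => intro f; exact gradedCommutator_zero_left 𝒜 _
    | succ k ih => intro f; rw [gradedCommutator_zero_left]; exact ih
  smul_mem' := by
    change ∀ (c : A) (D : Module.End ℝ A), IsDiffOp 𝒜 k D → IsDiffOp 𝒜 k (c • D)
    induction k with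
    | zero => intro c D hD f; rw [gradedCommutator_smul h𝒜, hD f, smul_zero]
    | succ k ih =>
      intro c D hD f
      rw [gradedCommutator_smul h𝒜]
      exact ih c _ (hD f)

end DiffOp

/-! ### `ℤ₂ⁿ`-manifolds -/

/-- A topological space with a sheaf of `ℤ₂ⁿ`-graded `ℤ₂ⁿ`-commutative associative unital
`ℝ`-algebras. -/
structure RingedSpace (n : ℕ) extends
    AlgebraicGeometry.SheafedSpace.{u + 1, u, u} (AlgCat.{u} ℝ) where
  /-- The homogeneous parts of the algebra of sections over `U`. -/
  part : ∀ U : Opens carrier, Deg n → Submodule ℝ (presheaf.obj (op U))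
  [graded : ∀ U, GradedAlgebra (part U)]
  map_mem_part : ∀ {U V : Opens carrier} (h : V ≤ U) (γ : Deg n), ∀ f ∈ part U γ,
    (presheaf.map (homOfLE h).op).hom f ∈ part V γ
  graded_comm : ∀ U, GradedCommutative (part U)

attribute [instance] RingedSpace.graded

/-- A ring with a set of homogeneous elements is graded local if it has a unique maximal
homogeneous ideal, that is, a unique ideal which is maximal among the proper ideals that are
generated by homogeneous elements. -/
def IsGradedLocal {R : Type*} [Ring R] (hom : Set R) : Prop :=
  ∃! I : Ideal R, Maximal (fun J : Ideal R => J ≠ ⊤ ∧ Ideal.span {a | a ∈ J ∧ a ∈ hom} = J) I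

/-- The image of an open subset of the source of a partial homeomorphism. -/
def imageOpens {X Y : Type*} [TopologicalSpace X] [TopologicalSpace Y]
    (φ : OpenPartialHomeomorph X Y) (W : Opens X) (hW : (W : Set X) ⊆ φ.source) : Opens Y :=
  ⟨φ '' W, φ.isOpen_image_of_subset_source W.isOpen hW⟩

theorem imageOpens_mono {X Y : Type*} [TopologicalSpace X] [TopologicalSpace Y]
    {φ : OpenPartialHomeomorph X Y} {V W : Opens X} (hW : (W : Set X) ⊆ φ.source) (h : V ≤ W) :
    imageOpens φ V (Set.Subset.trans h hW) ≤ imageOpens φ W hW :=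
  Set.image_mono h

namespace RingedSpace

variable {n : ℕ} (X : RingedSpace.{u} n)

/-- The sections of the structure sheaf. -/
abbrev Sec (U : Opens X.carrier) : Type u := X.presheaf.obj (op U)

/-- The restriction of sections of the structure sheaf. -/
def res {U V : Opens X.carrier} (h : V ≤ U) : X.Sec U →ₐ[ℝ] X.Sec V :=
  (X.presheaf.map (homOfLE h).op).hom

/-- The structure sheaf as a presheaf of rings. -/
def ringPresheaf : TopCat.Presheaf RingCat.{u} X.carrier :=
  X.presheaf ⋙ forget₂ (AlgCat.{u} ℝ) RingCat.{u}

/-- The germs at `x` of homogeneous sections. -/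
def homogeneousGerms (x : X.carrier) : Set (X.ringPresheaf.stalk x) :=
  {s | ∃ (U : Opens X.carrier) (hx : x ∈ U) (γ : Deg n), ∃ f ∈ X.part U γ,
    X.ringPresheaf.germ U x hx f = s}

/-- A coordinate chart: an isomorphism of an open subspace of `X` with an open subspace of the
domain `ℝ^{p|q}`, made of a homeomorphism `φ` and of degree-preserving isomorphisms of algebras of
sections that commute with restrictions. -/
structure Chart (p : ℕ) (q : {γ : Deg n // γ ≠ 0} → ℕ) where
  /-- The homeomorphism on the base. -/
  φ : OpenPartialHomeomorph X.carrier (Base p)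
  /-- The coordinate expression of sections. -/
  equiv : ∀ (W : Opens X.carrier) (hW : (W : Set X.carrier) ⊆ φ.source),
    X.Sec W ≃ₐ[ℝ] DomainSections q (imageOpens φ W hW)
  equiv_mem_homogeneous : ∀ W hW γ f,
    equiv W hW f ∈ Series.homogeneous γ ↔ f ∈ X.part W γ
  equiv_res : ∀ {V W : Opens X.carrier} (hW : (W : Set X.carrier) ⊆ φ.source) (h : V ≤ W) f,
    equiv V (Set.Subset.trans h hW) (X.res h f) =
      domainRes q (imageOpens_mono hW h) (equiv W hW f)

/-- A `ℤ₂ⁿ`-manifold of dimension `p|q`: a locally ringed space that is locally isomorphic to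
`ℝ^{p|q}`, with Hausdorff second-countable underlying topological space. -/
structure IsManifold (p : ℕ) (q : {γ : Deg n // γ ≠ 0} → ℕ) : Prop where
  t2 : T2Space X.carrier
  secondCountable : SecondCountableTopology X.carrier
  local_stalk : ∀ x : X.carrier, IsGradedLocal (X.homogeneousGerms x)
  exists_chart : ∀ x : X.carrier, ∃ c : X.Chart p q, x ∈ c.φ.source

namespace Chart

variable {X} {p k : ℕ} {q : {γ : Deg n // γ ≠ 0} → ℕ} (c : X.Chart p q)

/-- The domain of a chart. -/
def source : Opens X.carrier := ⟨c.φ.source, c.φ.open_source⟩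

/-- The operator `∂_ζ^γ ∂_θ^β ∂_x^α` in the coordinates of a chart, over an open subset `W` of the
chart domain. -/
def deriv (W : Opens X.carrier) (hW : W ≤ c.source) (i : DerivIdx p q k) :
    Module.End ℝ (X.Sec W) :=
  (c.equiv W hW).symm.toLinearMap ∘ₗ domainDeriv _ i ∘ₗ (c.equiv W hW).toLinearMap

end Chart

/-! ### The sheaf of differential operators -/

/-- The module of `k`-th order differential operators over `U`. -/
abbrev diffOp (k : ℕ) (U : Opens X.carrier) : Submodule (X.Sec U) (Module.End ℝ (X.Sec U)) :=
  Z2n.diffOp (X.graded_comm U) k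

/-- The differential operators of order `k` and of degree `γ`. -/
def diffOpPart (k : ℕ) (U : Opens X.carrier) (γ : Deg n) : Submodule ℝ (X.diffOp k U) :=
  (endHomogeneous (X.part U) γ).comap ((X.diffOp k U).subtype.restrictScalars ℝ)

/-- The differential operators of order `k` over `U` form a `ℤ₂ⁿ`-graded module. -/
structure IsGradedDiffOp (k : ℕ) (U : Opens X.carrier) : Prop where
  isInternal : DirectSum.IsInternal (X.diffOpPart k U)
  smul_mem : ∀ γ δ, ∀ f ∈ X.part U γ, ∀ D ∈ X.diffOpPart k U δ, f • D ∈ X.diffOpPart k U (γ + δ)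

/-- The structure of a presheaf of `ℤ₂ⁿ`-graded modules over the structure sheaf on the assignment
`U ↦ D^k(U)`, with restrictions such that `(D|_V)(g|_V) = (D g)|_V`. -/
structure DiffOpPresheaf (k : ℕ) where
  /-- The restriction of differential operators. -/
  res : ∀ {U V : Opens X.carrier}, V ≤ U → X.diffOp k U →+ X.diffOp k V
  res_apply : ∀ {U V : Opens X.carrier} (h : V ≤ U) (D : X.diffOp k U) (g : X.Sec U),
    (res h D).1 (X.res h g) = X.res h (D.1 g)
  res_smul : ∀ {U V : Opens X.carrier} (h : V ≤ U) (f : X.Sec U) (D : X.diffOp k U),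
    res h (f • D) = X.res h f • res h D
  res_mem_part : ∀ {U V : Opens X.carrier} (h : V ≤ U) (γ : Deg n), ∀ D ∈ X.diffOpPart k U γ,
    res h D ∈ X.diffOpPart k V γ
  res_self : ∀ (U : Opens X.carrier) (D : X.diffOp k U), res (le_refl U) D = D
  res_res : ∀ {U V W : Opens X.carrier} (h : V ≤ U) (h' : W ≤ V) (D : X.diffOp k U),
    res h' (res h D) = res (h'.trans h) D

namespace DiffOpPresheaf

variable {X} {k : ℕ} (F : X.DiffOpPresheaf k)

/-- The underlying presheaf of abelian groups. -/
def toPresheaf : TopCat.Presheaf AddCommGrpCat.{u} X.carrier where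
  obj U := AddCommGrpCat.of (X.diffOp k U.unop)
  map f := AddCommGrpCat.ofHom (F.res f.unop.le)
  map_id U := by
    exact AddCommGrpCat.hom_ext (AddMonoidHom.ext fun D => F.res_self U.unop D)
  map_comp f g := by
    exact AddCommGrpCat.hom_ext
      (AddMonoidHom.ext fun D => (F.res_res f.unop.le g.unop.le D).symm)

/-- The homogeneous sections `e i`, of degree `d i`, over `U` are a basis of the graded modules of
differential operators over all open subsets of `U`. -/
def IsLocalBasis (U : Opens X.carrier) {I : Type} (d : I → Deg n) (e : I → X.diffOp k U) : Prop :=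
  (∀ i, e i ∈ X.diffOpPart k U (d i)) ∧
    ∀ (V : Opens X.carrier) (h : V ≤ U),
      ∃ b : Module.Basis I (X.Sec V) (X.diffOp k V), ∀ i, b i = F.res h (e i)

/-- Locally, there is a finite basis of homogeneous sections. -/
def IsLocallyFree : Prop :=
  ∀ x : X.carrier, ∃ U : Opens X.carrier, x ∈ U ∧
    ∃ (I : Type) (_ : Finite I) (d : I → Deg n) (e : I → X.diffOp k U), F.IsLocalBasis U d e

end DiffOpPresheaf

end RingedSpace

end Z2n

end

noncomputable section

namespace Z2n

/-! The proof has an algebraic half, carried out over one algebra of sections, and a sheaf-theoretic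
half. Orders are counted strictly: `OrdLT 𝒜 k` means order less than `k`, so every induction starts
from `D = 0`.

Algebra. Suppose that a graded commutative algebra has homogeneous coordinates `X a`, dual graded
derivations `P a`, and is rigid: a homogeneous operator that graded commutes with all `X a` and
kills `1` is zero (`GradedCoordinates`). Then an operator of order less than `k` is determined by
its values on products of fewer than `k` coordinates: if these vanish, so do the corresponding
values of the commutators with the `X a`, which have lower order and vanish by induction; rigidity
finishes (`eq_zero_of_word_of_mem`). On monomials of degree at most that of the operator, a product
of derivatives `P^i` kills `X^j` unless `i = j`, where it gives a non-zero real number. This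
triangularity yields independence, and generation by successive correction of the values on
monomials of degree `0, 1, …, k` (`exists_basis`).

Rigidity of `C^∞(V)[[ξ]]`. Every series is a constant term plus multiples of the `ξ_a`. Passing an
operator through `ξ_a` lowers the multi-index of the coefficient under study, so induction on that
multi-index replaces any continuity assumption (`Series.end_eq_zero`). For the constant term,
Hadamard's lemma at `x₀` writes a function as a number plus a combination of the `x_i - x₀_i`, and
these factors vanish at `x₀` (`domain_end_eq_zero`).

Sheaf theory. Charts and the Hausdorff property give bump functions (`IsManifold.hasBumps`), hence
local extensions of sections. An operator of order less than `k` sends multiples of `σ^k`, with `σ`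
of degree zero, to multiples of `σ`; with `σ` equal to one minus a bump function this proves
locality (`res_apply_eq_zero`). Locality makes restrictions unique (`Restricts.unique`) and lets
them be built by gluing the images of local extensions (`exists_opFamily`). Since commutators are
compatible with restriction, the order is a local property, which gives the sheaf axiom. Finally the
basis theorem applies over every open subset of a chart domain. -/

theorem sgn_zero_left {n : ℕ} (γ : Deg n) : sgn 0 γ = 1 := by simp [sgn]

theorem sgn_zero_right {n : ℕ} (γ : Deg n) : sgn γ 0 = 1 := by simp [sgn]

theorem deg_add_self {n : ℕ} (γ : Deg n) : γ + γ = 0 :=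
  funext fun i => CharTwo.add_self_eq_zero (γ i)

theorem sgn_self {n : ℕ} (γ : Deg n) : sgn γ γ = (-1) ^ (parity γ).val := by
  have h : ∀ a : ZMod 2, a * a = a := by decide
  simp [sgn, parity, h]

theorem sgn_self_of_isOdd {n : ℕ} {γ : Deg n} (h : IsOdd γ) : sgn γ γ = -1 := by
  rw [sgn_self, show parity γ = 1 from h]
  simp [ZMod.val_one]

theorem sgn_self_of_not_isOdd {n : ℕ} {γ : Deg n} (h : ¬ IsOdd γ) : sgn γ γ = 1 := by
  have h2 : ∀ a : ZMod 2, a ≠ 1 → a = 0 := by decide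
  rw [sgn_self, h2 _ h]
  simp

/-! ### Homogeneous components and orders of operators -/

section GradedOps

variable {n : ℕ} {A : Type*} [Ring A] [Algebra ℝ A] (𝒜 : Deg n → Submodule ℝ A)
variable [GradedAlgebra 𝒜]

theorem proj_mem (γ : Deg n) (a : A) : GradedAlgebra.proj 𝒜 γ a ∈ 𝒜 γ := by
  rw [GradedAlgebra.proj_apply]; exact SetLike.coe_mem _

theorem proj_of_mem {γ : Deg n} {a : A} (h : a ∈ 𝒜 γ) (δ : Deg n) :
    GradedAlgebra.proj 𝒜 δ a = if δ = γ then a else 0 := by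
  rw [GradedAlgebra.proj_apply]
  split_ifs with e
  · subst e; exact DirectSum.decompose_of_mem_same 𝒜 h
  · exact DirectSum.decompose_of_mem_ne 𝒜 h (Ne.symm e)

/-- A property of elements that is additive holds if it holds for homogeneous elements. -/
theorem homogeneous_induction {P : A → Prop} (h0 : P 0) (hadd : ∀ a b, P a → P b → P (a + b))
    (hom : ∀ γ, ∀ a ∈ 𝒜 γ, P a) (a : A) : P a := by
  induction a using DirectSum.Decomposition.inductionOn 𝒜 with
  | zero => exact h0
  | homogeneous a => exact hom _ _ a.2
  | add a b ha hb => exact hadd a b ha hb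

theorem endComponent_mem (γ : Deg n) (D : Module.End ℝ A) :
    endComponent 𝒜 γ D ∈ endHomogeneous 𝒜 γ := by
  intro δ a ha
  rw [endComponent_apply, Finset.sum_eq_single δ]
  · exact proj_mem 𝒜 _ _
  · intro ε _ hε
    simp [proj_of_mem 𝒜 ha, hε]
  · simp

theorem endComponent_of_mem {γ : Deg n} {D : Module.End ℝ A} (h : D ∈ endHomogeneous 𝒜 γ)
    (δ : Deg n) : endComponent 𝒜 δ D = if δ = γ then D else 0 := by
  ext a
  rw [endComponent_apply]
  have : ∀ ε, GradedAlgebra.proj 𝒜 (ε + δ) (D (GradedAlgebra.proj 𝒜 ε a)) =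
      if δ = γ then D (GradedAlgebra.proj 𝒜 ε a) else 0 := by
    intro ε
    rw [proj_of_mem 𝒜 (h ε _ (proj_mem 𝒜 ε a))]
    simp
  simp only [this]
  split_ifs
  · rw [← map_sum, sum_proj]
  · simp

theorem endComponent_zero (γ : Deg n) : endComponent 𝒜 γ (0 : Module.End ℝ A) = 0 := by
  ext a; simp [endComponent_apply]

theorem mulLeft_mem {φ : Deg n} {f : A} (hf : f ∈ 𝒜 φ) :
    LinearMap.mulLeft ℝ f ∈ endHomogeneous 𝒜 φ := by
  intro δ a ha
  rw [add_comm]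
  exact SetLike.mul_mem_graded hf ha

theorem mul_mem_endHomogeneous {γ δ : Deg n} {D E : Module.End ℝ A}
    (hD : D ∈ endHomogeneous 𝒜 γ) (hE : E ∈ endHomogeneous 𝒜 δ) :
    D * E ∈ endHomogeneous 𝒜 (γ + δ) := by
  intro ε a ha
  rw [add_comm γ, ← add_assoc]
  exact hD _ _ (hE _ _ ha)

theorem one_mem_endHomogeneous : (1 : Module.End ℝ A) ∈ endHomogeneous 𝒜 (0 : Deg n) := by
  intro ε a ha
  simpa using ha

theorem gradedCommutator_hom {γ φ : Deg n} {D : Module.End ℝ A} (hD : D ∈ endHomogeneous 𝒜 γ)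
    {f : A} (hf : f ∈ 𝒜 φ) :
    gradedCommutator 𝒜 D (LinearMap.mulLeft ℝ f) =
      D * LinearMap.mulLeft ℝ f - sgn γ φ • (LinearMap.mulLeft ℝ f * D) := by
  rw [gradedCommutator_mulLeft 𝒜 hf, Finset.sum_eq_single γ]
  · simp [endComponent_of_mem 𝒜 hD]
  · intro δ _ hδ
    simp [endComponent_of_mem 𝒜 hD, hδ]
  · simp

theorem gradedCommutator_mem {γ φ : Deg n} {D : Module.End ℝ A} (hD : D ∈ endHomogeneous 𝒜 γ)
    {f : A} (hf : f ∈ 𝒜 φ) :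
    gradedCommutator 𝒜 D (LinearMap.mulLeft ℝ f) ∈ endHomogeneous 𝒜 (γ + φ) := by
  rw [gradedCommutator_hom 𝒜 hD hf]
  refine Submodule.sub_mem _ (mul_mem_endHomogeneous 𝒜 hD (mulLeft_mem 𝒜 hf))
    (Submodule.smul_mem _ _ ?_)
  rw [add_comm]
  exact mul_mem_endHomogeneous 𝒜 (mulLeft_mem 𝒜 hf) hD

/-- The commutator with an element of degree `φ` shifts degrees by `φ`, so it commutes with taking
components up to this shift. -/
theorem endComponent_gradedCommutator {φ : Deg n} {f : A} (hf : f ∈ 𝒜 φ) (D : Module.End ℝ A)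
    (γ : Deg n) : endComponent 𝒜 (γ + φ) (gradedCommutator 𝒜 D (LinearMap.mulLeft ℝ f)) =
      gradedCommutator 𝒜 (endComponent 𝒜 γ D) (LinearMap.mulLeft ℝ f) := by
  -- Checked on partial sums of homogeneous components, where each term contributes in a single
  -- degree; the full sum is `D`.
  have hsum : ∀ s : Finset (Deg n), endComponent 𝒜 (γ + φ) (gradedCommutator 𝒜
      (∑ δ ∈ s, endComponent 𝒜 δ D) (LinearMap.mulLeft ℝ f)) =
      if γ ∈ s then gradedCommutator 𝒜 (endComponent 𝒜 γ D) (LinearMap.mulLeft ℝ f) else 0 := by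
    intro s
    induction s using Finset.induction_on with
    | empty => simp [gradedCommutator_zero_left, endComponent_zero]
    | insert δ s hδ ih =>
      rw [Finset.sum_insert hδ, gradedCommutator_add_left, endComponent_add, ih,
        endComponent_of_mem 𝒜 (gradedCommutator_mem 𝒜 (endComponent_mem 𝒜 δ D) hf)]
      simp only [add_left_inj, Finset.mem_insert]
      by_cases h : γ = δ
      · subst h; simp [hδ]
      · simp [h]
  have := hsum Finset.univ
  rw [sum_endComponent] at this
  simpa using this

/-- Differential operators of order less than `k`. -/
def OrdLT : ℕ → Module.End ℝ A → Prop
  | 0, D => D = 0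
  | k + 1, D => ∀ f : A, OrdLT k (gradedCommutator 𝒜 D (LinearMap.mulLeft ℝ f))

theorem isDiffOp_iff_ordLT (k : ℕ) (D : Module.End ℝ A) : IsDiffOp 𝒜 k D ↔ OrdLT 𝒜 (k + 1) D := by
  induction k generalizing D with
  | zero => rfl
  | succ k ih => exact forall_congr' fun f => ih _

namespace OrdLT

variable {𝒜}

theorem zero (k : ℕ) : OrdLT 𝒜 k (0 : Module.End ℝ A) := by
  induction k with
  | zero => rfl
  | succ k ih => intro f; rw [gradedCommutator_zero_left]; exact ih

theorem add {k : ℕ} {D E : Module.End ℝ A} (hD : OrdLT 𝒜 k D) (hE : OrdLT 𝒜 k E) :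
    OrdLT 𝒜 k (D + E) := by
  induction k generalizing D E with
  | zero => rw [show D = 0 from hD, show E = 0 from hE, add_zero]; rfl
  | succ k ih =>
    intro f
    rw [gradedCommutator_add_left]
    exact ih (hD f) (hE f)

theorem sum {ι : Type*} {k : ℕ} (s : Finset ι) {D : ι → Module.End ℝ A}
    (hD : ∀ i ∈ s, OrdLT 𝒜 k (D i)) : OrdLT 𝒜 k (∑ i ∈ s, D i) :=
  Finset.sum_induction _ _ (fun _ _ => add) (zero k) hD

/-- The commutator is additive in the multiplier and homogeneous elements generate `A` additively.
This gives access to the explicit sign formula `gradedCommutator_hom`. -/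
theorem of_homogeneous {k : ℕ} {D : Module.End ℝ A}
    (h : ∀ φ, ∀ f ∈ 𝒜 φ, OrdLT 𝒜 k (gradedCommutator 𝒜 D (LinearMap.mulLeft ℝ f))) :
    OrdLT 𝒜 (k + 1) D := by
  intro f
  induction f using homogeneous_induction 𝒜 with
  | h0 => simpa [gradedCommutator_zero_right] using zero k
  | hadd a b ha hb =>
    have e : LinearMap.mulLeft ℝ (a + b) = LinearMap.mulLeft ℝ a + LinearMap.mulLeft ℝ b := by
      ext; simp [add_mul]
    rw [e, gradedCommutator_add_right]
    exact ha.add hb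
  | hom γ a ha => exact h γ a ha

theorem endComponent {k : ℕ} {D : Module.End ℝ A} (hD : OrdLT 𝒜 k D) (γ : Deg n) :
    OrdLT 𝒜 k (endComponent 𝒜 γ D) := by
  induction k generalizing D γ with
  | zero => rw [show D = 0 from hD, endComponent_zero]; rfl
  | succ k ih =>
    refine of_homogeneous fun φ f hf => ?_
    rw [← endComponent_gradedCommutator 𝒜 hf]
    exact ih (hD f) _

theorem succ {k : ℕ} {D : Module.End ℝ A} (hD : OrdLT 𝒜 k D) : OrdLT 𝒜 (k + 1) D := by
  induction k generalizing D with
  | zero => rw [show D = 0 from hD]; exact zero _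
  | succ k ih => exact fun f => ih (hD f)

theorem mono {k l : ℕ} (h : k ≤ l) {D : Module.End ℝ A} (hD : OrdLT 𝒜 k D) : OrdLT 𝒜 l D := by
  induction h with
  | refl => exact hD
  | step _ ih => exact ih.succ

theorem smul_real {k : ℕ} {D : Module.End ℝ A} (hD : OrdLT 𝒜 k D) (r : ℝ) :
    OrdLT 𝒜 k (r • D) := by
  induction k generalizing D with
  | zero => rw [show D = 0 from hD, smul_zero]; rfl
  | succ k ih =>
    intro f
    have : gradedCommutator 𝒜 (r • D) (LinearMap.mulLeft ℝ f) =
        r • gradedCommutator 𝒜 D (LinearMap.mulLeft ℝ f) := by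
      have hc : ∀ γ, Z2n.endComponent 𝒜 γ (r • D) = r • Z2n.endComponent 𝒜 γ D := fun γ => by
        ext a
        simp [endComponent_apply, Finset.smul_sum]
      simp only [gradedCommutator, hc, Finset.smul_sum, smul_sub]
      refine Finset.sum_congr rfl fun _ _ => Finset.sum_congr rfl fun _ _ => ?_
      rw [smul_comm r (sgn _ _), smul_mul_assoc, mul_smul_comm]
    rw [this]
    exact ih (hD f)

theorem sub {k : ℕ} {D E : Module.End ℝ A} (hD : OrdLT 𝒜 k D) (hE : OrdLT 𝒜 k E) :
    OrdLT 𝒜 k (D - E) := by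
  rw [sub_eq_add_neg, ← neg_one_smul ℝ E]
  exact hD.add (hE.smul_real _)

theorem mul_left {m : ℕ} (h𝒜 : GradedCommutative 𝒜) {D : Module.End ℝ A} (hD : OrdLT 𝒜 m D)
    (f : A) : OrdLT 𝒜 m (f • D) := by
  cases m with
  | zero => rw [show D = 0 from hD, smul_zero]; rfl
  | succ k =>
    rw [← isDiffOp_iff_ordLT] at hD ⊢
    exact (diffOp h𝒜 k).smul_mem f hD

/-- The composition of homogeneous operators of orders less than `k + 1` and less than `l + 1` has
order less than `k + l + 1`. -/
theorem mul {k l : ℕ} {γ δ : Deg n} {D E : Module.End ℝ A} (hD' : D ∈ endHomogeneous 𝒜 γ)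
    (hE' : E ∈ endHomogeneous 𝒜 δ) (hD : OrdLT 𝒜 (k + 1) D) (hE : OrdLT 𝒜 (l + 1) E) :
    OrdLT 𝒜 (k + l + 1) (D * E) := by
  induction h : k + l generalizing k l γ δ D E with
  | zero =>
    obtain ⟨rfl, rfl⟩ : k = 0 ∧ l = 0 := by omega
    refine of_homogeneous fun φ f hf => ?_
    have h1 := hD f
    have h2 := hE f
    rw [gradedCommutator_hom 𝒜 hD' hf] at h1
    rw [gradedCommutator_hom 𝒜 hE' hf] at h2
    rw [gradedCommutator_hom 𝒜 (mul_mem_endHomogeneous 𝒜 hD' hE') hf]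
    change _ = 0 at h1 h2 ⊢
    rw [sub_eq_zero] at h1 h2 ⊢
    rw [mul_assoc, h2, mul_smul_comm, ← mul_assoc, h1, smul_mul_assoc, smul_smul, sgn_add_left,
      mul_comm (sgn γ φ), mul_assoc]
  | succ N ih =>
    refine of_homogeneous fun φ f hf => ?_
    have h1 := hD f
    have h2 := hE f
    -- Graded Leibniz rule `[DE, f] = D [E, f] ± [D, f] E`: in each term one factor has dropped in
    -- order.
    have e : gradedCommutator 𝒜 (D * E) (LinearMap.mulLeft ℝ f) =
        D * gradedCommutator 𝒜 E (LinearMap.mulLeft ℝ f) +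
          sgn δ φ • (gradedCommutator 𝒜 D (LinearMap.mulLeft ℝ f) * E) := by
      rw [gradedCommutator_hom 𝒜 (mul_mem_endHomogeneous 𝒜 hD' hE') hf,
        gradedCommutator_hom 𝒜 hD' hf, gradedCommutator_hom 𝒜 hE' hf, mul_sub, sub_mul, smul_sub,
        sgn_add_left, smul_mul_assoc, smul_smul, mul_smul_comm, mul_comm (sgn γ φ)]
      simp only [mul_assoc]
      abel
    rw [e]
    refine add ?_ (smul_real ?_ _)
    -- For `l = 0` the commutator of `E` is zero outright; only for a successor does the induction
    -- hypothesis apply.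
    · cases l with
      | zero => rw [show gradedCommutator 𝒜 E _ = 0 from h2, mul_zero]; exact zero _
      | succ l => exact ih hD' (gradedCommutator_mem 𝒜 hE' hf) hD h2 (by omega)
    · cases k with
      | zero => rw [show gradedCommutator 𝒜 D _ = 0 from h1, zero_mul]; exact zero _
      | succ k => exact ih (gradedCommutator_mem 𝒜 hD' hf) hE' h1 hE (by omega)

theorem one : OrdLT 𝒜 1 (1 : Module.End ℝ A) := by
  refine of_homogeneous fun φ f hf => ?_
  rw [gradedCommutator_hom 𝒜 (one_mem_endHomogeneous 𝒜) hf, sgn_zero_left, one_smul, one_mul,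
    mul_one, sub_self]
  rfl

theorem pow {γ : Deg n} {D : Module.End ℝ A} (hD' : D ∈ endHomogeneous 𝒜 γ)
    (hD : OrdLT 𝒜 2 D) (m : ℕ) :
    OrdLT 𝒜 (m + 1) (D ^ m) ∧ D ^ m ∈ endHomogeneous 𝒜 (m • γ) := by
  induction m with
  | zero => simpa using ⟨one, one_mem_endHomogeneous 𝒜⟩
  | succ m ih =>
    rw [pow_succ, succ_nsmul]
    exact ⟨mul ih.2 hD' ih.1 hD, mul_mem_endHomogeneous 𝒜 ih.2 hD'⟩

theorem list_prod {ι : Type*} (L : List ι) {P : ι → Module.End ℝ A} {d : ι → Deg n} {i : ι → ℕ}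
    (hP : ∀ a, P a ∈ endHomogeneous 𝒜 (d a)) (hP' : ∀ a, OrdLT 𝒜 2 (P a)) :
    OrdLT 𝒜 ((L.map i).sum + 1) (L.map fun a => P a ^ i a).prod ∧
      (L.map fun a => P a ^ i a).prod ∈ endHomogeneous 𝒜 (L.map fun a => i a • d a).sum := by
  induction L with
  | nil => simpa using ⟨one, one_mem_endHomogeneous 𝒜⟩
  | cons a L ih =>
    simp only [List.map_cons, List.sum_cons, List.prod_cons]
    have := pow (hP a) (hP' a) (i a)
    exact ⟨mul this.2 ih.2 this.1 ih.1, mul_mem_endHomogeneous 𝒜 this.2 ih.2⟩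

/-- A graded derivation is a differential operator of first order. -/
theorem of_leibniz {γ : Deg n} {D : Module.End ℝ A} (hD : D ∈ endHomogeneous 𝒜 γ)
    (h𝒜 : GradedCommutative 𝒜)
    (h : ∀ φ, ∀ f ∈ 𝒜 φ, ∀ g, D (f * g) = D f * g + sgn γ φ • (f * D g)) : OrdLT 𝒜 2 D := by
  refine of_homogeneous fun φ f hf => ?_
  have e : gradedCommutator 𝒜 D (LinearMap.mulLeft ℝ f) = D f • 1 := by
    rw [gradedCommutator_hom 𝒜 hD hf]
    ext g
    simp [h φ f hf]
  rw [e]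
  exact one.mul_left h𝒜 _

end OrdLT

/-- The maps `π i` read off the components of the image of an external sum, which gives injectivity;
`hsum` gives surjectivity. -/
theorem isInternal_of_projections {ι M : Type*} [Fintype ι] [DecidableEq ι] [AddCommMonoid M]
    [Module ℝ M] (p : ι → Submodule ℝ M) (π : ι → M →+ M) (hπ : ∀ i m, π i m ∈ p i)
    (hsum : ∀ m, ∑ i, π i m = m) (hp : ∀ i j, ∀ m ∈ p j, π i m = if i = j then m else 0) :
    DirectSum.IsInternal p := by
  have key : ∀ (x : DirectSum ι fun i => p i) i,
      π i (DirectSum.coeAddMonoidHom p x) = (x i : M) := by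
    intro x i
    induction x using DirectSum.induction_on with
    | zero => simp
    | of j m =>
      rw [DirectSum.coeAddMonoidHom_of, hp i j _ m.2]
      split_ifs with h
      · subst h; simp
      · rw [DirectSum.of_eq_of_ne _ _ _ h]; rfl
    | add x y hx hy => rw [map_add, map_add, hx, hy]; rfl
  constructor
  · intro x y h
    refine DFinsupp.ext fun i => Subtype.ext ?_
    change (x i : M) = y i
    rw [← key x i, ← key y i, h]
  · intro m
    refine ⟨∑ i, DirectSum.of (fun i => p i) i ⟨π i m, hπ i m⟩, ?_⟩
    simp [map_sum, DirectSum.coeAddMonoidHom_of, hsum]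

variable {𝒜} in
/-- The component of a differential operator. -/
def diffOpComponent (h𝒜 : GradedCommutative 𝒜) (k : ℕ) (γ : Deg n) :
    diffOp h𝒜 k →+ diffOp h𝒜 k where
  toFun D := ⟨endComponent 𝒜 γ D.1,
    (isDiffOp_iff_ordLT 𝒜 k _).2 (((isDiffOp_iff_ordLT 𝒜 k _).1 D.2).endComponent γ)⟩
  map_zero' := Subtype.ext (endComponent_zero 𝒜 γ)
  map_add' D E := Subtype.ext (endComponent_add 𝒜 γ D.1 E.1)

variable {𝒜} in
theorem isInternal_diffOp (h𝒜 : GradedCommutative 𝒜) (k : ℕ) :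
    DirectSum.IsInternal fun γ : Deg n => (endHomogeneous 𝒜 γ).comap
      ((diffOp h𝒜 k).subtype.restrictScalars ℝ) := by
  refine isInternal_of_projections _ (diffOpComponent h𝒜 k) ?_ ?_ ?_
  · exact fun γ D => endComponent_mem 𝒜 γ D.1
  · intro D
    apply Subtype.ext
    rw [AddSubmonoidClass.coe_finsetSum]
    exact sum_endComponent 𝒜 D.1
  · intro γ δ D hD
    apply Subtype.ext
    refine (endComponent_of_mem 𝒜 hD γ).trans ?_
    split_ifs <;> rfl

end GradedOps

/-! ### Differential operators of an algebra with coordinates -/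

/-- The numbers `1 + s + ⋯ + s^(j-1)`. -/
def signedCount (s : ℝ) : ℕ → ℝ
  | 0 => 0
  | j + 1 => 1 + s * signedCount s j

theorem signedCount_one (j : ℕ) : signedCount 1 j = j := by
  induction j with
  | zero => simp [signedCount]
  | succ j ih => simp [signedCount, ih, add_comm]

/-- Coordinates of a graded algebra: homogeneous elements `X a` and graded derivations `P a` dual to
them, such that a homogeneous operator which commutes with the multiplications by all coordinates
and annihilates the unit vanishes. -/
structure GradedCoordinates {n : ℕ} {A : Type*} [Ring A] [Algebra ℝ A]
    (𝒜 : Deg n → Submodule ℝ A) {ι : Type*} [DecidableEq ι] (d : ι → Deg n) where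
  /-- The coordinates. -/
  X : ι → A
  /-- The partial derivatives. -/
  P : ι → Module.End ℝ A
  X_mem : ∀ a, X a ∈ 𝒜 (d a)
  P_mem : ∀ a, P a ∈ endHomogeneous 𝒜 (d a)
  leibniz : ∀ a φ, ∀ f ∈ 𝒜 φ, ∀ g, P a (f * g) = P a f * g + sgn (d a) φ • (f * P a g)
  P_X : ∀ a b, P a (X b) = if a = b then 1 else 0
  rigid : ∀ γ, ∀ E ∈ endHomogeneous 𝒜 γ,
    (∀ a f, E (X a * f) = sgn γ (d a) • (X a * E f)) → E 1 = 0 → E = 0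

namespace GradedCoordinates

variable {n : ℕ} {A : Type*} [Ring A] [Algebra ℝ A] {𝒜 : Deg n → Submodule ℝ A}
  [GradedAlgebra 𝒜] {ι : Type*} [DecidableEq ι] {d : ι → Deg n} (C : GradedCoordinates 𝒜 d)

/-- The product of the coordinates in a list. -/
def word (w : List ι) : A := (w.map C.X).prod

/-- The product of powers of the coordinates, in the order of a list. -/
def mono (L : List ι) (j : ι → ℕ) : A := (L.map fun a => C.X a ^ j a).prod

/-- The product of powers of the derivatives, in the reverse order of a list. -/
def diff (L : List ι) (i : ι → ℕ) : Module.End ℝ A := (L.reverse.map fun a => C.P a ^ i a).prod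

theorem diff_cons (a : ι) (L : List ι) (i : ι → ℕ) :
    C.diff (a :: L) i = C.diff L i * C.P a ^ i a := by
  simp [diff]

theorem word_mem (w : List ι) : C.word w ∈ 𝒜 (w.map d).sum := by
  induction w with
  | nil => exact SetLike.one_mem_graded 𝒜
  | cons a w ih => exact SetLike.mul_mem_graded (C.X_mem a) ih

theorem P_one (a : ι) : C.P a 1 = 0 := by
  have := C.leibniz a 0 1 (SetLike.one_mem_graded 𝒜) 1
  rw [sgn_zero_right, one_smul] at this
  simpa using this

theorem P_X_mul (a b : ι) (g : A) :
    C.P a (C.X b * g) = (if a = b then g else 0) + sgn (d a) (d b) • (C.X b * C.P a g) := by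
  rw [C.leibniz a (d b) _ (C.X_mem b), C.P_X]
  split_ifs <;> simp

theorem P_pow_mul_of_ne {a b : ι} (h : a ≠ b) (m : ℕ) (g : A) :
    C.P a (C.X b ^ m * g) = sgn (d a) (d b) ^ m • (C.X b ^ m * C.P a g) := by
  induction m with
  | zero => simp
  | succ m ih =>
    rw [pow_succ', mul_assoc, C.P_X_mul, if_neg h, ih, zero_add, mul_smul_comm, smul_smul,
      pow_succ', mul_assoc]

theorem P_mono_of_notMem {a : ι} {L : List ι} (h : a ∉ L) (j : ι → ℕ) :
    C.P a (C.mono L j) = 0 := by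
  induction L with
  | nil => simpa [mono] using C.P_one a
  | cons b L ih =>
    simp only [List.mem_cons, not_or] at h
    have : C.mono (b :: L) j = C.X b ^ j b * C.mono L j := by simp [mono]
    rw [this, C.P_pow_mul_of_ne h.1, ih h.2, mul_zero, smul_zero]

/-- Derivatives in other coordinates pass through `X b` up to signs. All that matters later is that
the scalar does not depend on `g`. -/
theorem diff_pow_mul {b : ι} {L : List ι} (h : b ∉ L) (i : ι → ℕ) (m : ℕ) :
    ∃ r : ℝ, ∀ g, C.diff L i (C.X b ^ m * g) = r • (C.X b ^ m * C.diff L i g) := by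
  induction L with
  | nil => exact ⟨1, fun g => by simp [diff]⟩
  | cons a L ih =>
    simp only [List.mem_cons, not_or] at h
    obtain ⟨r, hr⟩ := ih h.2
    have hp : ∀ k : ℕ, ∃ s : ℝ, ∀ g, (C.P a ^ k) (C.X b ^ m * g) =
        s • (C.X b ^ m * (C.P a ^ k) g) := by
      intro k
      induction k with
      | zero => exact ⟨1, fun g => by simp⟩
      | succ k ihk =>
        obtain ⟨s, hs⟩ := ihk
        refine ⟨s * sgn (d a) (d b) ^ m, fun g => ?_⟩
        rw [pow_succ', Module.End.mul_apply, hs, map_smul, C.P_pow_mul_of_ne (Ne.symm h.1),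
          smul_smul, Module.End.mul_apply]
    obtain ⟨s, hs⟩ := hp (i a)
    refine ⟨s * r, fun g => ?_⟩
    rw [diff_cons, Module.End.mul_apply, hs, map_smul, hr, smul_smul, Module.End.mul_apply]

theorem P_pow_mul_self {a : ι} {g : A} (hg : C.P a g = 0) (j : ℕ) :
    C.P a (C.X a ^ j * g) = signedCount (sgn (d a) (d a)) j • (C.X a ^ (j - 1) * g) := by
  induction j with
  | zero => simp [signedCount, hg]
  | succ j ih =>
    rw [pow_succ', mul_assoc, C.P_X_mul, if_pos rfl, ih, signedCount, add_smul, one_smul,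
      mul_smul_comm, smul_smul, Nat.add_sub_cancel]
    -- For `j = 0` the truncated exponent `j - 1` is harmless, because its factor `signedCount _ 0`
    -- is zero.
    cases j with
    | zero => simp [signedCount]
    | succ j => rw [← mul_assoc, ← pow_succ', Nat.add_sub_cancel]

theorem P_pow_pow_mul_self {a : ι} {g : A} (hg : C.P a g = 0) (i j : ℕ) :
    (C.P a ^ i) (C.X a ^ j * g) =
      (∏ l ∈ Finset.range i, signedCount (sgn (d a) (d a)) (j - l)) • (C.X a ^ (j - i) * g) := by
  induction i with
  | zero => simp
  | succ i ih =>
    rw [pow_succ', Module.End.mul_apply, ih, map_smul, C.P_pow_mul_self hg, smul_smul,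
      Finset.prod_range_succ, Nat.sub_sub]

/-- Derivatives are composed in the reverse order of the monomial, so the power of `P b` acting
first meets the power of `X b` at the front, while the rest of the monomial is killed by `P b`. -/
theorem diff_mono_of_lt {L : List ι} (hL : L.Nodup) {i j : ι → ℕ} {a : ι} (ha : a ∈ L)
    (h : j a < i a) : C.diff L i (C.mono L j) = 0 := by
  induction L with
  | nil => simp at ha
  | cons b L ih =>
    rw [List.nodup_cons] at hL
    have : C.mono (b :: L) j = C.X b ^ j b * C.mono L j := by simp [mono]
    rw [diff_cons, this, Module.End.mul_apply,
      C.P_pow_pow_mul_self (C.P_mono_of_notMem hL.1 j), map_smul]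
    by_cases hab : a = b
    · subst hab
      -- The factor with `l = j a` is `signedCount _ 0 = 0`.
      rw [Finset.prod_eq_zero (Finset.mem_range.2 h) (by simp [signedCount]), zero_smul]
    · obtain ⟨r, hr⟩ := C.diff_pow_mul hL.1 i (j b - i b)
      rw [hr, ih hL.2 ((List.mem_cons.1 ha).resolve_left hab), mul_zero, smul_zero, smul_zero]

theorem diff_mono_self {L : List ι} (hL : L.Nodup) {i : ι → ℕ}
    (hi : ∀ a, IsOdd (d a) → i a ≤ 1) :
    ∃ r : ℝ, r ≠ 0 ∧ C.diff L i (C.mono L i) = algebraMap ℝ A r := by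
  induction L with
  | nil => exact ⟨1, one_ne_zero, by simp [diff, mono]⟩
  | cons b L ih =>
    rw [List.nodup_cons] at hL
    have : C.mono (b :: L) i = C.X b ^ i b * C.mono L i := by simp [mono]
    obtain ⟨r, hr0, hr⟩ := ih hL.2
    refine ⟨(∏ l ∈ Finset.range (i b), signedCount (sgn (d b) (d b)) (i b - l)) * r,
      mul_ne_zero (Finset.prod_ne_zero_iff.2 fun l hl => ?_) hr0, ?_⟩
    · rw [Finset.mem_range] at hl
      -- For an odd coordinate the exponent is at most `1` and the only possible factor is `1`;
      -- otherwise the sign is `1` and the factor is the positive integer `i b - l`.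
      by_cases hb : IsOdd (d b)
      · have h1 : i b - l = 1 := by have := hi b hb; omega
        simp [h1, signedCount]
      · rw [sgn_self_of_not_isOdd hb, signedCount_one]
        exact Nat.cast_ne_zero.2 (by omega)
    · rw [diff_cons, this, Module.End.mul_apply,
        C.P_pow_pow_mul_self (C.P_mono_of_notMem hL.1 i), map_smul, Nat.sub_self, pow_zero,
        one_mul, hr, map_mul, Algebra.smul_def]

/-- The coordinates in the word `w` can be sorted, up to a scalar factor. -/
theorem word_perm (h𝒜 : GradedCommutative 𝒜) {w w' : List ι} (h : w.Perm w') :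
    ∃ r : ℝ, C.word w = r • C.word w' := by
  induction h with
  | nil => exact ⟨1, by simp⟩
  | @cons a w w' _ ih =>
    obtain ⟨r, hr⟩ := ih
    refine ⟨r, ?_⟩
    simp only [word, List.map_cons, List.prod_cons] at hr ⊢
    rw [hr, mul_smul_comm]
  | swap a b w =>
    refine ⟨sgn (d b) (d a), ?_⟩
    simp only [word, List.map_cons, List.prod_cons]
    rw [← mul_assoc, ← mul_assoc, h𝒜 _ _ _ (C.X_mem b) _ (C.X_mem a), smul_mul_assoc]
  | trans _ _ ih1 ih2 =>
    obtain ⟨r, hr⟩ := ih1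
    obtain ⟨s, hs⟩ := ih2
    exact ⟨r * s, by rw [hr, hs, smul_smul]⟩

theorem perm_flatMap_replicate {L : List ι} (hL : L.Nodup) (hL' : ∀ a, a ∈ L) (w : List ι) :
    w.Perm (L.flatMap fun a => List.replicate (w.count a) a) := by
  rw [List.perm_iff_count]
  intro b
  have key : ∀ L : List ι, L.Nodup → (L.flatMap fun a => List.replicate (w.count a) a).count b =
      if b ∈ L then w.count b else 0 := by
    intro L hL
    induction L with
    | nil => simp
    | cons a L ih =>
      rw [List.nodup_cons] at hL
      rw [List.flatMap_cons, List.count_append, ih hL.2, List.count_replicate]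
      by_cases hab : a = b
      · subst hab; simp [hL.1]
      · simp [hab, Ne.symm hab]
  rw [key L hL, if_pos (hL' b)]

theorem word_flatMap_replicate (L : List ι) (j : ι → ℕ) :
    C.word (L.flatMap fun a => List.replicate (j a) a) = C.mono L j := by
  induction L with
  | nil => rfl
  | cons a L ih =>
    simp only [word, mono] at ih ⊢
    simp [ih]

theorem X_sq_of_isOdd (h𝒜 : GradedCommutative 𝒜) {a : ι} (ha : IsOdd (d a)) :
    C.X a ^ 2 = 0 := by
  have := h𝒜 _ _ _ (C.X_mem a) _ (C.X_mem a)
  rw [sgn_self_of_isOdd ha, neg_one_smul, eq_neg_iff_add_eq_zero, ← two_smul ℝ] at this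
  rw [sq]
  exact (smul_eq_zero.1 this).resolve_left two_ne_zero

theorem mono_eq_zero (h𝒜 : GradedCommutative 𝒜) {a : ι} (ha : IsOdd (d a)) {L : List ι}
    (haL : a ∈ L) {j : ι → ℕ} (hj : 2 ≤ j a) : C.mono L j = 0 := by
  refine List.prod_eq_zero (List.mem_map.2 ⟨a, haL, ?_⟩)
  rw [← Nat.sub_add_cancel hj, pow_add, C.X_sq_of_isOdd h𝒜 ha, mul_zero]

/-- A homogeneous differential operator of order less than `k` which annihilates the products of
less than `k` coordinates vanishes. -/
theorem eq_zero_of_word_of_mem {k : ℕ} {γ : Deg n} {D : Module.End ℝ A}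
    (hD : D ∈ endHomogeneous 𝒜 γ) (hk : OrdLT 𝒜 k D)
    (h : ∀ w : List ι, w.length < k → D (C.word w) = 0) : D = 0 := by
  induction k generalizing γ D with
  | zero => exact hk
  | succ k ih =>
    -- The empty word provides `D 1 = 0`; it remains to see that `D` graded commutes with the
    -- coordinates.
    refine C.rigid γ D hD (fun a f => ?_) (h [] (by simp))
    -- The commutator with `X a` has lower order, and its value on a word `w` involves only the
    -- values of `D` on `a :: w` and on `w`.
    have h0 : gradedCommutator 𝒜 D (LinearMap.mulLeft ℝ (C.X a)) = 0 := by
      refine ih (gradedCommutator_mem 𝒜 hD (C.X_mem a)) (hk _) fun w hw => ?_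
      rw [gradedCommutator_hom 𝒜 hD (C.X_mem a)]
      have h1 : D (C.X a * C.word w) = 0 := h (a :: w) (by simpa using hw)
      simp [h1, h w (by omega)]
    rw [gradedCommutator_hom 𝒜 hD (C.X_mem a), sub_eq_zero] at h0
    exact LinearMap.congr_fun h0 f

theorem eq_zero_of_word {k : ℕ} {D : Module.End ℝ A} (hk : OrdLT 𝒜 k D)
    (h : ∀ w : List ι, w.length < k → D (C.word w) = 0) : D = 0 := by
  rw [← sum_endComponent 𝒜 D]
  refine Finset.sum_eq_zero fun γ _ => C.eq_zero_of_word_of_mem (endComponent_mem 𝒜 γ D)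
    (hk.endComponent γ) fun w hw => ?_
  -- A word is homogeneous, so a component of `D` sends it to a component of its image under `D`,
  -- which is zero.
  rw [endComponent_apply]
  refine Finset.sum_eq_zero fun δ _ => ?_
  rw [proj_of_mem 𝒜 (C.word_mem w)]
  split_ifs
  · rw [h w hw, map_zero]
  · rw [map_zero, map_zero]

theorem sum_count_eq_length [Fintype ι] (w : List ι) : ∑ a, w.count a = w.length := by
  induction w with
  | nil => simp
  | cons b w ih => simp [List.count_cons, Finset.sum_add_distrib, ih]

/-- Sorting turns a word into a scalar multiple of an ordered monomial, which vanishes as soon as an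
odd coordinate is repeated. Hence testing admissible monomials suffices. -/
theorem eq_zero_of_mono (h𝒜 : GradedCommutative 𝒜) [Fintype ι] {L : List ι} (hL : L.Nodup)
    (hL' : ∀ a, a ∈ L) {k : ℕ} {D : Module.End ℝ A} (hk : OrdLT 𝒜 k D)
    (h : ∀ j : ι → ℕ, (∀ a, IsOdd (d a) → j a ≤ 1) → ∑ a, j a < k → D (C.mono L j) = 0) :
    D = 0 := by
  refine C.eq_zero_of_word hk fun w hw => ?_
  obtain ⟨r, hr⟩ := C.word_perm h𝒜 (perm_flatMap_replicate hL hL' w)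
  rw [hr, map_smul, C.word_flatMap_replicate]
  by_cases hadm : ∀ a, IsOdd (d a) → w.count a ≤ 1
  · rw [h _ hadm, smul_zero]
    refine lt_of_le_of_lt (le_of_eq ?_) hw
    exact sum_count_eq_length w
  · push Not at hadm
    obtain ⟨a, ha, ha'⟩ := hadm
    rw [C.mono_eq_zero h𝒜 ha (hL' a) ha', map_zero, smul_zero]

theorem ordLT_diff (h𝒜 : GradedCommutative 𝒜) (L : List ι) (i : ι → ℕ) :
    OrdLT 𝒜 ((L.map i).sum + 1) (C.diff L i) ∧
      C.diff L i ∈ endHomogeneous 𝒜 (L.map fun a => i a • d a).sum := by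
  have := OrdLT.list_prod L.reverse (i := i) C.P_mem
    fun a => OrdLT.of_leibniz (C.P_mem a) h𝒜 (C.leibniz a)
  have h1 : (L.reverse.map i).sum = (L.map i).sum := by
    rw [List.map_reverse, List.sum_reverse]
  have h2 : (L.reverse.map fun a => i a • d a).sum = (L.map fun a => i a • d a).sum := by
    rw [List.map_reverse, List.sum_reverse]
  rwa [h1, h2] at this

theorem exists_lt_of_sum_le [Fintype ι] {i j : ι → ℕ} (h : ∑ a, j a ≤ ∑ a, i a) (hne : i ≠ j) :
    ∃ a, j a < i a := by
  by_contra! hc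
  have := (Finset.sum_eq_sum_iff_of_le fun a _ => hc a).1
    (le_antisymm (Finset.sum_le_sum fun a _ => hc a) h)
  exact hne (funext fun a => this a (Finset.mem_univ a))

/-- The products of derivatives form a basis of the module of differential operators. -/
theorem exists_basis (h𝒜 : GradedCommutative 𝒜) [Fintype ι] {L : List ι} (hL : L.Nodup)
    (hL' : ∀ a, a ∈ L) {k : ℕ} {I : Type*} [Fintype I] {idx : I → ι → ℕ}
    (hidx : Function.Injective idx)
    (hrange : ∀ j, (∃ i, idx i = j) ↔ (∀ a, IsOdd (d a) → j a ≤ 1) ∧ ∑ a, j a ≤ k)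
    (e : I → diffOp h𝒜 k) (he : ∀ i, (e i).1 = C.diff L (idx i)) :
    ∃ b : Module.Basis I A (diffOp h𝒜 k), ∀ i, b i = e i := by
  classical
  have hcoe : ∀ (s : Finset I) (c : I → A) (f : A),
      (∑ i ∈ s, c i • e i : diffOp h𝒜 k).1 f = ∑ i ∈ s, c i * C.diff L (idx i) f := by
    intro s c f
    rw [AddSubmonoidClass.coe_finsetSum, LinearMap.sum_apply]
    refine Finset.sum_congr rfl fun i _ => ?_
    rw [Submodule.coe_smul, he, LinearMap.smul_apply, smul_eq_mul]
  have hadm : ∀ i a, IsOdd (d a) → idx i a ≤ 1 := fun i => ((hrange _).1 ⟨i, rfl⟩).1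
  have hzero : ∀ i (j : ι → ℕ), ∑ a, j a ≤ ∑ a, idx i a → idx i ≠ j →
      C.diff L (idx i) (C.mono L j) = 0 := fun i j h hne => by
    obtain ⟨a, ha⟩ := exists_lt_of_sum_le h hne
    exact C.diff_mono_of_lt hL (hL' a) ha
  choose r hr0 hr using fun i => C.diff_mono_self hL (hadm i)
  -- Strong induction on the degree of the index: a relation is evaluated at the monomial of
  -- exponent `idx i`. Coefficients of lower degree vanish by induction, the other operators of
  -- equal or higher degree kill the monomial, and `c i` remains with the factor `r i ≠ 0`.
  have hli : LinearIndependent A e := by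
    refine LinearIndependent.of_comp (diffOp h𝒜 k).subtype ?_
    rw [Fintype.linearIndependent_iff]
    intro c hc
    suffices h : ∀ m i, ∑ a, idx i a = m → c i = 0 from fun i => h _ i rfl
    intro m
    induction m using Nat.strong_induction_on with
    | _ m ih =>
      intro i hi
      have h1 := LinearMap.congr_fun hc (C.mono L (idx i))
      have h2 : ∀ i f, (c i • (e i).1) f = c i * C.diff L (idx i) f := fun i f => by
        rw [he, LinearMap.smul_apply, smul_eq_mul]
      simp only [Function.comp_apply, Submodule.subtype_apply, LinearMap.sum_apply, h2,
        LinearMap.zero_apply] at h1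
      rw [Finset.sum_eq_single i, hr] at h1
      · rw [← Algebra.commutes, ← Algebra.smul_def] at h1
        exact (smul_eq_zero.1 h1).resolve_left (hr0 i)
      · intro i' _ hne
        rcases lt_or_ge (∑ a, idx i' a) (∑ a, idx i a) with hlt | hge
        · rw [ih _ (hi ▸ hlt) i' rfl, zero_mul]
        · rw [hzero i' _ hge (hidx.ne hne), mul_zero]
      · simp
  -- Successive approximation: `T` agrees with `D` on admissible monomials of degree less than `m`.
  -- At `m = k + 1` these monomials determine the operator.
  have hstep : ∀ m ≤ k + 1, ∀ D : diffOp h𝒜 k, ∃ T ∈ Submodule.span A (Set.range e),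
      ∀ j : ι → ℕ, (∀ a, IsOdd (d a) → j a ≤ 1) → ∑ a, j a < m →
        D.1 (C.mono L j) - T.1 (C.mono L j) = 0 := by
    intro m
    induction m with
    | zero => exact fun _ D => ⟨0, Submodule.zero_mem _, fun j _ h => absurd h (Nat.not_lt_zero _)⟩
    | succ m ih =>
      intro hm D
      obtain ⟨T, hT, hDT⟩ := ih (by omega) D
      -- The error on the monomial of exponent `idx i`, divided by the value of the `i`-th operator
      -- there. Operators of degree `m` kill the monomials of lower degree and the other monomials
      -- of degree `m`, so nothing achieved is spoiled.
      let c : I → A := fun i => (r i)⁻¹ • (D.1 (C.mono L (idx i)) - T.1 (C.mono L (idx i)))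
      let s : Finset I := Finset.univ.filter fun i => ∑ a, idx i a = m
      refine ⟨T + ∑ i ∈ s, c i • e i, Submodule.add_mem _ hT (Submodule.sum_mem _ fun i _ =>
        Submodule.smul_mem _ _ (Submodule.subset_span ⟨i, rfl⟩)), fun j hj hjm => ?_⟩
      change D.1 (C.mono L j) - (T.1 (C.mono L j) +
        (∑ i ∈ s, c i • e i : diffOp h𝒜 k).1 (C.mono L j)) = 0
      rw [hcoe, ← sub_sub, sub_eq_zero]
      rcases Nat.lt_succ_iff_lt_or_eq.1 hjm with hlt | heq
      · rw [hDT j hj hlt]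
        symm
        refine Finset.sum_eq_zero fun i hi => ?_
        have hi' : ∑ a, idx i a = m := (Finset.mem_filter.1 hi).2
        rw [hzero i j (by omega) (by rintro rfl; omega), mul_zero]
      · obtain ⟨i, rfl⟩ := (hrange j).2 ⟨hj, by omega⟩
        rw [Finset.sum_eq_single i, hr]
        · rw [← Algebra.commutes, ← Algebra.smul_def, smul_smul, mul_inv_cancel₀ (hr0 i), one_smul]
        · intro i' hi' hne
          have hi'' : ∑ a, idx i' a = m := (Finset.mem_filter.1 hi').2
          rw [hzero i' _ (by omega) (hidx.ne hne), mul_zero]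
        · intro hi
          exact absurd (show i ∈ s by simp [s, heq]) hi
  have hspan : ⊤ ≤ Submodule.span A (Set.range e) := by
    rintro D -
    obtain ⟨T, hT, hDT⟩ := hstep (k + 1) le_rfl D
    have h0 : D.1 - T.1 = 0 := C.eq_zero_of_mono h𝒜 hL hL'
      (((isDiffOp_iff_ordLT 𝒜 k _).1 D.2).sub ((isDiffOp_iff_ordLT 𝒜 k _).1 T.2))
      fun j hj hjk => hDT j hj hjk
    rwa [show D = T from Subtype.ext (sub_eq_zero.1 h0)]
  exact ⟨Module.Basis.mk hli hspan, fun i => Module.Basis.mk_apply hli hspan i⟩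

end GradedCoordinates

/-! ### Calculus of formal power series -/

namespace Series

variable {n : ℕ} {ι : Type} [Fintype ι] [LinearOrder ι] {d : ι → Deg n} {R : Type} [CommRing R]
  [Algebra ℝ R]

/-- The sign which arises when a variable of degree `d a` is moved past the variables `b < a` in a
monomial. -/
def leftSign (d : ι → Deg n) (a : ι) (α : ι →₀ ℕ) : ℝ :=
  ∏ b, if b < a then sgn (d a) (d b) ^ α b else 1

/-- The sign which arises when a variable of degree `d a` is moved past the variables `b > a` in a
monomial. -/
def rightSign (d : ι → Deg n) (a : ι) (α : ι →₀ ℕ) : ℝ :=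
  ∏ b, if a < b then sgn (d a) (d b) ^ α b else 1

theorem leftSign_add (a : ι) (α β : ι →₀ ℕ) :
    leftSign d a (α + β) = leftSign d a α * leftSign d a β := by
  simp only [leftSign, ← Finset.prod_mul_distrib]
  refine Finset.prod_congr rfl fun b _ => ?_
  split_ifs
  · rw [Finsupp.add_apply, pow_add]
  · simp

theorem leftSign_single (a : ι) : leftSign d a (Finsupp.single a 1) = 1 := by
  refine Finset.prod_eq_one fun b _ => ?_
  split_ifs with h
  · simp [h.ne']
  · rfl

theorem leftSign_add_single (a : ι) (α : ι →₀ ℕ) :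
    leftSign d a (α + Finsupp.single a 1) = leftSign d a α := by
  rw [leftSign_add, leftSign_single, mul_one]

theorem sgn_pow_mul_self (γ δ : Deg n) (m : ℕ) : sgn γ δ ^ m * sgn γ δ ^ m = 1 := by
  rw [← mul_pow, sgn_mul_self, one_pow]

theorem leftSign_mul_self (a : ι) (α : ι →₀ ℕ) : leftSign d a α * leftSign d a α = 1 := by
  rw [leftSign, ← Finset.prod_mul_distrib]
  refine Finset.prod_eq_one fun b _ => ?_
  split_ifs
  · exact sgn_pow_mul_self _ _ _
  · simp

theorem cocycle_single_left (a : ι) (β : ι →₀ ℕ) :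
    cocycle d (Finsupp.single a 1) β = leftSign d a β := by
  rw [cocycle, Finset.prod_eq_single a]
  · simp [leftSign]
  · intro c _ hc
    exact Finset.prod_eq_one fun b _ => by simp [Finsupp.single_eq_of_ne hc]
  · simp

theorem cocycle_single_right (a : ι) (α : ι →₀ ℕ) :
    cocycle d α (Finsupp.single a 1) = rightSign d a α := by
  rw [cocycle, rightSign]
  refine Finset.prod_congr rfl fun c _ => ?_
  rw [Finset.prod_eq_single a]
  · simp [sgn_comm]
  · intro b _ hb
    simp [Finsupp.single_eq_of_ne hb]
  · simp

theorem sgn_monDeg (γ : Deg n) (α : ι →₀ ℕ) : sgn γ (monDeg d α) = ∏ b, sgn γ (d b) ^ α b := by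
  have hs : ∀ s : Finset ι, sgn γ (∑ b ∈ s, α b • d b) = ∏ b ∈ s, sgn γ (d b) ^ α b := by
    intro s
    induction s using Finset.induction_on with
    | empty => simp [sgn_zero_right]
    | insert b s hb ih =>
      rw [Finset.sum_insert hb, Finset.prod_insert hb, sgn_add_right, ih]
      congr 1
      induction α b with
      | zero => simp [sgn_zero_right]
      | succ m ihm => rw [succ_nsmul, sgn_add_right, ihm, pow_succ]
  exact hs Finset.univ

/-- The product over all variables is split into those before, at and after `a`; this matches the
sign `sgn (d a) φ` of the Leibniz rule with the signs of the product and of the derivative. -/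
theorem sgn_monDeg_eq (a : ι) (α : ι →₀ ℕ) : sgn (d a) (monDeg d α) =
    leftSign d a α * sgn (d a) (d a) ^ α a * rightSign d a α := by
  have h : sgn (d a) (d a) ^ α a = ∏ b, if b = a then sgn (d a) (d b) ^ α b else 1 := by simp
  rw [sgn_monDeg, h, leftSign, rightSign, ← Finset.prod_mul_distrib, ← Finset.prod_mul_distrib]
  refine Finset.prod_congr rfl fun b _ => ?_
  rcases lt_trichotomy b a with h | h | h
  · simp [h, h.ne, h.not_gt]
  · simp [h]
  · simp [h, h.ne', h.not_gt]

theorem monDeg_add (α β : ι →₀ ℕ) : monDeg d (α + β) = monDeg d α + monDeg d β := by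
  simp [monDeg, add_smul, Finset.sum_add_distrib]

theorem monDeg_single (a : ι) : monDeg d (Finsupp.single a 1) = d a := by
  rw [monDeg, Finset.sum_eq_single a]
  · simp
  · intro b _ hb
    simp [Finsupp.single_eq_of_ne hb]
  · simp

theorem coeff_of_not_admissible {α : ι →₀ ℕ} (h : ¬ Admissible d α) (f : Series d R) :
    coeff α f = 0 := by
  simp [coeff, h]

theorem coeff_sum {κ : Type*} (s : Finset κ) (f : κ → Series d R) (α : ι →₀ ℕ) :
    coeff α (∑ i ∈ s, f i) = ∑ i ∈ s, coeff α (f i) := by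
  classical
  induction s using Finset.induction_on with
  | empty => simp [coeff_zero]
  | insert i s hi ih => rw [Finset.sum_insert hi, Finset.sum_insert hi, coeff_add, ih]

theorem coeff_formalDeriv (a : ι) (α : ι →₀ ℕ) (f : Series d R) :
    coeff α (formalDeriv a f) =
      (leftSign d a α * (α a + 1 : ℝ)) • coeff (α + Finsupp.single a 1) f := by
  by_cases h : Admissible d α
  · simp only [coeff, h, dite_true]
    rfl
  · rw [coeff_of_not_admissible h, coeff_of_not_admissible fun h' =>
      h (Admissible.of_add_left h'), smul_zero]

theorem coeff_mapCoeff {S : Type} [CommRing S] [Algebra ℝ S] (φ : R →ₗ[ℝ] S) (α : ι →₀ ℕ)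
    (f : Series d R) : coeff α (mapCoeff φ f) = φ (coeff α f) := by
  by_cases h : Admissible d α
  · simp only [coeff, h, dite_true]
    rfl
  · rw [coeff_of_not_admissible h, coeff_of_not_admissible h, map_zero]

/-- The variable `ξ_a`. -/
def var (a : ι) : Series d R := fun α => if α.1 = Finsupp.single a 1 then 1 else 0

/-- The series with a constant term only. -/
def const (r : R) : Series d R := fun α => if α.1 = 0 then r else 0

theorem admissible_single (a : ι) : Admissible d (Finsupp.single a 1) := fun b _ => by
  rw [Finsupp.single_apply]; split_ifs <;> simp

theorem coeff_var (a : ι) (α : ι →₀ ℕ) :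
    coeff α (var a : Series d R) = if α = Finsupp.single a 1 then 1 else 0 := by
  by_cases h : Admissible d α
  · simp only [coeff, h, dite_true]
    rfl
  · rw [coeff_of_not_admissible h, if_neg]
    rintro rfl
    exact h (admissible_single a)

theorem coeff_const (r : R) (α : ι →₀ ℕ) :
    coeff α (const r : Series d R) = if α = 0 then r else 0 := by
  by_cases h : Admissible d α
  · simp only [coeff, h, dite_true]
    rfl
  · rw [coeff_of_not_admissible h, if_neg]
    rintro rfl
    exact h fun _ _ => by simp

theorem const_one : const 1 = (1 : Series d R) := by
  ext α h
  rw [coeff_const, coeff_one]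

theorem const_add (r s : R) : (const (r + s) : Series d R) = const r + const s := by
  ext α h
  simp only [coeff_const, coeff_add]
  split_ifs <;> simp

theorem const_smul (t : ℝ) (r : R) : (const (t • r) : Series d R) = t • const r := by
  ext α h
  simp only [coeff_const, coeff_smul]
  split_ifs <;> simp

theorem const_sum {κ : Type*} (s : Finset κ) (r : κ → R) :
    (const (∑ i ∈ s, r i) : Series d R) = ∑ i ∈ s, const (r i) := by
  ext α h
  simp only [coeff_const, coeff_sum]
  split_ifs <;> simp

theorem coeff_const_mul (r : R) (f : Series d R) (α : ι →₀ ℕ) :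
    coeff α (const r * f) = r * coeff α f := by
  by_cases h : Admissible d α
  · rw [coeff_mul h, Finset.sum_eq_single (0, α)]
    · simp [coeff_const, cocycle_zero_left]
    · rintro ⟨a, b⟩ hab hne
      have : a ≠ 0 := by
        rintro rfl
        simp only [Finset.HasAntidiagonal.mem_antidiagonal, zero_add] at hab
        exact hne (by rw [hab])
      simp [coeff_const, this]
    · simp
  · rw [coeff_of_not_admissible h, coeff_of_not_admissible h, mul_zero]

theorem const_mul (r s : R) : (const (r * s) : Series d R) = const r * const s := by
  ext α h
  rw [coeff_const_mul, coeff_const, coeff_const]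
  split_ifs <;> simp

theorem coeff_var_mul (a : ι) {α : ι →₀ ℕ} (h : Admissible d α) (f : Series d R) :
    coeff α (var a * f) = if α a = 0 then 0 else
      leftSign d a α • coeff (α - Finsupp.single a 1) f := by
  rw [coeff_mul h]
  split_ifs with ha
  · refine Finset.sum_eq_zero fun p hp => ?_
    rw [Finset.HasAntidiagonal.mem_antidiagonal] at hp
    rw [coeff_var, if_neg, zero_mul, smul_zero]
    intro h1
    have := DFunLike.congr_fun hp a
    simp [h1, ha] at this
  · have hle : Finsupp.single a 1 ≤ α := by
      rw [Finsupp.single_le_iff]; omega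
    rw [Finset.sum_eq_single (Finsupp.single a 1, α - Finsupp.single a 1)]
    · have h2 : leftSign d a α = leftSign d a (α - Finsupp.single a 1) := by
        conv_lhs => rw [← tsub_add_cancel_of_le hle, leftSign_add_single]
      simp only [coeff_var, if_true, one_mul, cocycle_single_left, h2]
    · rintro ⟨μ, ν⟩ hp hne
      rw [Finset.HasAntidiagonal.mem_antidiagonal] at hp
      rw [coeff_var, if_neg, zero_mul, smul_zero]
      intro (h1 : μ = _)
      refine hne ?_
      simp only at hp
      rw [← hp, h1, add_tsub_cancel_left]
    · intro h1
      exact absurd (Finset.HasAntidiagonal.mem_antidiagonal.2 (add_tsub_cancel_of_le hle)) h1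

open Classical in
/-- The terms of a series whose smallest variable is `ξ_a`, divided by `ξ_a`. -/
def divVar (a : ι) (f : Series d R) : Series d R := fun μ =>
  if ∀ b < a, μ.1 b = 0 then coeff (μ.1 + Finsupp.single a 1) f else 0

/-- Every series is the sum of its constant term and of multiples of the variables. -/
theorem eq_const_add_sum (f : Series d R) :
    f = const (coeff 0 f) + ∑ a, var a * divVar a f := by
  classical
  ext α hα
  rw [coeff_add, coeff_const, coeff_sum]
  -- Each non-constant monomial is charged to its smallest variable, so exactly one summand
  -- contributes, and without a sign since no variable has to be passed.
  have key : ∀ a, coeff α (var a * divVar a f) =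
      if α a ≠ 0 ∧ ∀ b < a, α b = 0 then coeff α f else 0 := by
    intro a
    rw [coeff_var_mul a hα]
    by_cases ha : α a = 0
    · simp [ha]
    · have hle : Finsupp.single a 1 ≤ α := by
        rw [Finsupp.single_le_iff]; omega
      have hadm : Admissible d (α - Finsupp.single a 1) :=
        Admissible.of_add_left (β := Finsupp.single a 1) (by rwa [tsub_add_cancel_of_le hle])
      have hiff : (∀ b < a, (α - Finsupp.single a 1 : ι →₀ ℕ) b = 0) ↔ ∀ b < a, α b = 0 :=
        forall₂_congr fun b hb => by simp [Finsupp.single_eq_of_ne hb.ne]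
      have hdiv : coeff (α - Finsupp.single a 1) (divVar a f) =
          if ∀ b < a, (α - Finsupp.single a 1 : ι →₀ ℕ) b = 0 then
            coeff (α - Finsupp.single a 1 + Finsupp.single a 1) f else 0 := by
        rw [coeff, dif_pos hadm]
        rfl
      rw [if_neg ha, hdiv]
      simp only [hiff, tsub_add_cancel_of_le hle, ne_eq, ha, not_false_eq_true, true_and]
      split_ifs with h1
      · have : leftSign d a α = 1 := by
          refine Finset.prod_eq_one fun b _ => ?_
          split_ifs with hb
          · rw [h1 b hb, pow_zero]
          · rfl
        rw [this, one_smul]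
      · rw [smul_zero]
  simp only [key]
  by_cases h0 : α = 0
  · subst h0
    simp
  · rw [if_neg h0, zero_add]
    have hne : (Finset.univ.filter fun a => α a ≠ 0).Nonempty := by
      by_contra hc
      rw [Finset.not_nonempty_iff_eq_empty, Finset.filter_eq_empty_iff] at hc
      exact h0 (Finsupp.ext fun a => by simpa using hc (Finset.mem_univ a))
    have hm := Finset.min'_mem _ hne
    rw [Finset.mem_filter] at hm
    have hlt : ∀ b < (Finset.univ.filter fun a => α a ≠ 0).min' hne, α b = 0 := by
      intro b hb
      by_contra hc
      exact absurd (Finset.min'_le _ b (by simp [hc])) (not_le.2 hb)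
    rw [Finset.sum_eq_single ((Finset.univ.filter fun a => α a ≠ 0).min' hne)]
    · rw [if_pos ⟨hm.2, hlt⟩]
    · intro b _ hb
      rw [if_neg]
      rintro ⟨h1, h2⟩
      rcases lt_or_gt_of_ne hb with h | h
      · exact h1 (hlt b h)
      · exact hm.2 (h2 _ h)
    · simp

/-- An operator that commutes up to factors with the variables and annihilates the series with
constant terms only vanishes. -/
theorem end_eq_zero {E : Module.End ℝ (Series d R)}
    (hE : ∀ a, ∃ ε : ℝ, ∀ f, E (var a * f) = ε • (var a * E f)) (h0 : ∀ r, E (const r) = 0) :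
    E = 0 := by
  -- Induction on the degree of the coefficient that is read off, for all `f` at once: the
  -- coefficient of `ξ_a E(f_a)` at `α` is up to sign that of `E(f_a)` at `α - e_a`. No convergence
  -- is involved.
  suffices h : ∀ (N : ℕ) (f : Series d R) (α : ι →₀ ℕ), Admissible d α → ∑ a, α a < N →
      coeff α (E f) = 0 by
    ext f α hα
    rw [h _ f α hα (Nat.lt_succ_self _), LinearMap.zero_apply, coeff_zero]
  intro N
  induction N with
  | zero => exact fun f α _ h => absurd h (Nat.not_lt_zero _)
  | succ N ih =>
    intro f α hα hN
    rw [eq_const_add_sum f, map_add, h0, zero_add, map_sum, coeff_sum]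
    refine Finset.sum_eq_zero fun a _ => ?_
    obtain ⟨ε, hε⟩ := hE a
    rw [hε, coeff_smul, coeff_var_mul a hα]
    split_ifs with ha
    · rw [smul_zero]
    · have hle : Finsupp.single a 1 ≤ α := by
        rw [Finsupp.single_le_iff]; omega
      have hsum : ∑ b, (α - Finsupp.single a 1 : ι →₀ ℕ) b + 1 = ∑ b, α b := by
        conv_rhs => rw [← tsub_add_cancel_of_le hle]
        simp only [Finsupp.add_apply, Finset.sum_add_distrib]
        simp [Finsupp.single_apply]
      rw [ih _ _ (Admissible.of_add_left (β := Finsupp.single a 1)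
        (by rwa [tsub_add_cancel_of_le hle])) (by omega), smul_zero, smul_zero]

/-- The shift misses exactly the pairs with `μ a = 0`, where `F` vanishes. It brings the terms of
the Leibniz rule to a common index set. -/
theorem sum_antidiagonal_add_single_left {M : Type*} [AddCommMonoid M] (a : ι) (γ : ι →₀ ℕ)
    (F : (ι →₀ ℕ) → (ι →₀ ℕ) → M) (hF : ∀ μ ν, μ a = 0 → F μ ν = 0) :
    ∑ p ∈ Finset.HasAntidiagonal.antidiagonal γ, F (p.1 + Finsupp.single a 1) p.2 =
      ∑ p ∈ Finset.HasAntidiagonal.antidiagonal (γ + Finsupp.single a 1), F p.1 p.2 := by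
  refine Finset.sum_of_injOn (fun p => (p.1 + Finsupp.single a 1, p.2)) ?_ ?_ ?_ ?_
  · rintro ⟨μ, ν⟩ _ ⟨μ', ν'⟩ _ h
    simpa using h
  · rintro ⟨μ, ν⟩ h
    simp only [Finset.mem_coe, Finset.HasAntidiagonal.mem_antidiagonal] at h ⊢
    rw [← h, add_right_comm]
  · rintro ⟨μ, ν⟩ h hn
    refine hF _ _ ?_
    by_contra ha
    refine hn ⟨(μ - Finsupp.single a 1, ν), ?_, ?_⟩
    · have hle : Finsupp.single a 1 ≤ μ := by
        rw [Finsupp.single_le_iff]; simp only at ha; omega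
      simp only [Finset.mem_coe, Finset.HasAntidiagonal.mem_antidiagonal] at h ⊢
      rw [← add_left_inj (Finsupp.single a 1), ← h, add_right_comm, tsub_add_cancel_of_le hle]
    · have hle : Finsupp.single a 1 ≤ μ := by
        rw [Finsupp.single_le_iff]; simp only at ha; omega
      simp only [tsub_add_cancel_of_le hle]
  · intro p _
    rfl

theorem sum_antidiagonal_add_single_right {M : Type*} [AddCommMonoid M] (a : ι) (γ : ι →₀ ℕ)
    (F : (ι →₀ ℕ) → (ι →₀ ℕ) → M) (hF : ∀ μ ν, ν a = 0 → F μ ν = 0) :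
    ∑ p ∈ Finset.HasAntidiagonal.antidiagonal γ, F p.1 (p.2 + Finsupp.single a 1) =
      ∑ p ∈ Finset.HasAntidiagonal.antidiagonal (γ + Finsupp.single a 1), F p.1 p.2 := by
  have hswap : ∀ (α : ι →₀ ℕ) (G : (ι →₀ ℕ) → (ι →₀ ℕ) → M),
      ∑ p ∈ Finset.HasAntidiagonal.antidiagonal α, G p.1 p.2 =
        ∑ p ∈ Finset.HasAntidiagonal.antidiagonal α, G p.2 p.1 := fun α G =>
    Finset.sum_nbij' Prod.swap Prod.swap (by simp [add_comm]) (by simp [add_comm]) (by simp)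
      (by simp) (by simp)
  rw [hswap γ fun μ ν => F μ (ν + Finsupp.single a 1), hswap _ F]
  exact sum_antidiagonal_add_single_left a γ (fun μ ν => F ν μ) fun μ ν h => hF ν μ h

/-- After reindexing over pairs with sum `γ + e_a`, the claim compares the factor `γ a + 1` with `μ
a + s ^ μ a * ν a`, where `s = sgn (d a) (d a)`. For `s = 1` this is additivity of exponents. For
odd `ξ_a` the pairs `(0, 1)` and `(1, 0)` both give `1`, and `(1, 1)` gives `0`, in accordance with
`ξ_a ^ 2 = 0`. -/
theorem formalDeriv_leibniz (a : ι) {φ : Deg n} {f : Series d R} (hf : f ∈ homogeneous φ)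
    (g : Series d R) :
    formalDeriv a (f * g) = formalDeriv a f * g + sgn (d a) φ • (f * formalDeriv a g) := by
  ext γ hγ
  have h1 : coeff γ (formalDeriv a f * g) =
      ∑ p ∈ Finset.HasAntidiagonal.antidiagonal (γ + Finsupp.single a 1),
        (cocycle d p.1 p.2 * leftSign d a (p.1 + p.2) * (p.1 a : ℝ)) •
          (coeff p.1 f * coeff p.2 g) := by
    rw [← sum_antidiagonal_add_single_left a γ (fun μ ν =>
      (cocycle d μ ν * leftSign d a (μ + ν) * (μ a : ℝ)) • (coeff μ f * coeff ν g))
      (fun μ ν h => by simp [h]), coeff_mul hγ]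
    refine Finset.sum_congr rfl fun p _ => ?_
    rw [coeff_formalDeriv, smul_mul_assoc, smul_smul]
    congr 1
    rw [cocycle_add_left, cocycle_single_left, leftSign_add, leftSign_add_single]
    simp only [Finsupp.add_apply, Finsupp.single_eq_same, Nat.cast_add, Nat.cast_one]
    -- The sign of moving `ξ_a` past `p.2` occurs twice, in the cocycle and in `leftSign`, and
    -- squares to one.
    linear_combination (-(cocycle d p.1 p.2 * leftSign d a p.1 * (p.1 a + 1 : ℝ))) *
      leftSign_mul_self (d := d) a p.2
  have h2 : coeff γ (sgn (d a) φ • (f * formalDeriv a g)) =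
      ∑ p ∈ Finset.HasAntidiagonal.antidiagonal (γ + Finsupp.single a 1),
        (cocycle d p.1 p.2 * leftSign d a (p.1 + p.2) *
          (sgn (d a) (d a) ^ p.1 a * (p.2 a : ℝ))) • (coeff p.1 f * coeff p.2 g) := by
    rw [← sum_antidiagonal_add_single_right a γ (fun μ ν =>
      (cocycle d μ ν * leftSign d a (μ + ν) * (sgn (d a) (d a) ^ μ a * (ν a : ℝ))) •
        (coeff μ f * coeff ν g))
      (fun μ ν h => by simp [h]), coeff_smul, coeff_mul hγ, Finset.smul_sum]
    refine Finset.sum_congr rfl fun p _ => ?_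
    rw [coeff_formalDeriv, mul_smul_comm, smul_smul, smul_smul]
    -- Homogeneity of `f` allows `φ` to be replaced by the degree of the monomial wherever the
    -- coefficient is not forced to be zero.
    by_cases hp : monDeg d p.1 = φ
    · congr 1
      rw [← hp, sgn_monDeg_eq, cocycle_add_right, cocycle_single_right, leftSign_add,
        leftSign_add_single]
      simp only [Finsupp.add_apply, Finsupp.single_eq_same, Nat.cast_add, Nat.cast_one]
      ring
    · rw [hf p.1 hp, zero_mul, smul_zero, smul_zero]
  rw [coeff_add, h1, h2, ← Finset.sum_add_distrib, coeff_formalDeriv]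
  have h3 : ∀ p ∈ Finset.HasAntidiagonal.antidiagonal (γ + Finsupp.single a 1),
      (cocycle d p.1 p.2 * leftSign d a (p.1 + p.2) * (p.1 a : ℝ)) •
          (coeff p.1 f * coeff p.2 g) +
        (cocycle d p.1 p.2 * leftSign d a (p.1 + p.2) *
          (sgn (d a) (d a) ^ p.1 a * (p.2 a : ℝ))) • (coeff p.1 f * coeff p.2 g) =
      (leftSign d a γ * ((p.1 a : ℝ) + sgn (d a) (d a) ^ p.1 a * (p.2 a : ℝ))) •
        cocycle d p.1 p.2 • (coeff p.1 f * coeff p.2 g) := by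
    intro p hp
    rw [Finset.HasAntidiagonal.mem_antidiagonal] at hp
    rw [hp, leftSign_add_single, ← add_smul, smul_smul]
    congr 1
    ring
  rw [Finset.sum_congr rfl h3]
  by_cases hodd : IsOdd (d a)
  · have hγa := hγ a hodd
    rw [sgn_self_of_isOdd hodd]
    by_cases h0 : γ a = 0
    · have hadm : Admissible d (γ + Finsupp.single a 1) := by
        intro b hb
        by_cases hba : b = a
        · subst hba; simp [h0]
        · simpa [Finsupp.single_eq_of_ne hba] using hγ b hb
      rw [coeff_mul hadm, Finset.smul_sum]
      refine Finset.sum_congr rfl fun p hp => ?_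
      rw [Finset.HasAntidiagonal.mem_antidiagonal] at hp
      have := DFunLike.congr_fun hp a
      simp only [Finsupp.add_apply, Finsupp.single_eq_same, h0] at this
      obtain ⟨h5, h6⟩ | ⟨h5, h6⟩ : (p.1 a = 0 ∧ p.2 a = 1) ∨ (p.1 a = 1 ∧ p.2 a = 0) := by omega
      all_goals simp [h5, h6, h0]
    -- The left side is zero because the exponent `2` of an odd variable is not admissible; on the
    -- right the only admissible split `1 + 1` has factor `1 - 1`.
    · have hna : ¬ Admissible d (γ + Finsupp.single a 1) := by
        intro h
        have := h a hodd
        simp at this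
        omega
      rw [coeff_of_not_admissible hna, smul_zero]
      symm
      refine Finset.sum_eq_zero fun p hp => ?_
      rw [Finset.HasAntidiagonal.mem_antidiagonal] at hp
      have := DFunLike.congr_fun hp a
      simp only [Finsupp.add_apply, Finsupp.single_eq_same] at this
      by_cases h5 : Admissible d p.1
      · by_cases h6 : Admissible d p.2
        · have h7 := h5 a hodd
          have h8 := h6 a hodd
          obtain ⟨h9, h10⟩ : p.1 a = 1 ∧ p.2 a = 1 := by omega
          simp [h9, h10]
        · simp [coeff_of_not_admissible h6]
      · simp [coeff_of_not_admissible h5]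
  · have hadm : Admissible d (γ + Finsupp.single a 1) := by
      intro b hb
      have hba : b ≠ a := by rintro rfl; exact hodd hb
      simpa [Finsupp.single_eq_of_ne hba] using hγ b hb
    rw [sgn_self_of_not_isOdd hodd, coeff_mul hadm, Finset.smul_sum]
    refine Finset.sum_congr rfl fun p hp => ?_
    rw [Finset.HasAntidiagonal.mem_antidiagonal] at hp
    have h4 : ((p.1 a + p.2 a : ℕ) : ℝ) = ((γ a + 1 : ℕ) : ℝ) := by
      have := DFunLike.congr_fun hp a
      simp only [Finsupp.add_apply, Finsupp.single_eq_same] at this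
      rw [this]
    push_cast at h4
    rw [one_pow, one_mul, h4]

/-- Removing one `ξ_a` subtracts `d a`, which in `ℤ₂ⁿ` is the same as adding it. -/
theorem formalDeriv_mem (a : ι) {δ : Deg n} {f : Series d R} (hf : f ∈ homogeneous δ) :
    formalDeriv a f ∈ homogeneous (δ + d a) := by
  intro α hα
  rw [coeff_formalDeriv, hf, smul_zero]
  intro h
  rw [monDeg_add, monDeg_single] at h
  exact hα (by rw [← h, add_assoc, deg_add_self, add_zero])

theorem mapCoeff_mem {S : Type} [CommRing S] [Algebra ℝ S] (φ : R →ₗ[ℝ] S) {δ : Deg n}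
    {f : Series d R} (hf : f ∈ homogeneous δ) : mapCoeff φ f ∈ homogeneous δ := by
  intro α hα
  rw [coeff_mapCoeff, hf α hα, map_zero]

theorem var_mem (a : ι) : (var a : Series d R) ∈ homogeneous (d a) := by
  intro α hα
  rw [coeff_var, if_neg]
  rintro rfl
  exact hα (monDeg_single a)

theorem const_mem (r : R) : (const r : Series d R) ∈ homogeneous (0 : Deg n) := by
  intro α hα
  rw [coeff_const, if_neg]
  rintro rfl
  exact hα (by simp [monDeg])

theorem formalDeriv_const (a : ι) (r : R) : formalDeriv a (const r : Series d R) = 0 := by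
  ext α hα
  rw [coeff_formalDeriv, coeff_const, if_neg, smul_zero, coeff_zero]
  intro h
  simpa using DFunLike.congr_fun h a

theorem formalDeriv_var (a b : ι) :
    formalDeriv a (var b : Series d R) = if a = b then 1 else 0 := by
  ext α hα
  rw [coeff_formalDeriv, coeff_var]
  by_cases hab : a = b
  · subst hab
    by_cases h0 : α = 0
    · subst h0
      simp [coeff_one, leftSign]
    · simp [h0, coeff_one]
  · rw [if_neg, if_neg hab, smul_zero, coeff_zero]
    intro h
    simpa [Finsupp.single_eq_of_ne hab] using DFunLike.congr_fun h a

theorem mapCoeff_const {S : Type} [CommRing S] [Algebra ℝ S] (φ : R →ₗ[ℝ] S) (r : R) :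
    mapCoeff φ (const r : Series d R) = const (φ r) := by
  ext α hα
  rw [coeff_mapCoeff, coeff_const, coeff_const]
  split_ifs <;> simp

theorem mapCoeff_var {φ : R →ₗ[ℝ] R} (h : φ 1 = 0) (a : ι) :
    mapCoeff φ (var a : Series d R) = 0 := by
  ext α hα
  rw [coeff_mapCoeff, coeff_var, coeff_zero]
  split_ifs <;> simp [h]

theorem mapCoeff_leibniz {φ : R →ₗ[ℝ] R} (h : ∀ r s, φ (r * s) = φ r * s + r * φ s)
    (f g : Series d R) : mapCoeff φ (f * g) = mapCoeff φ f * g + f * mapCoeff φ g := by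
  ext α hα
  simp only [coeff_mapCoeff, coeff_mul hα, coeff_add, map_sum, map_smul, h, smul_add,
    Finset.sum_add_distrib]

theorem mapCoeff_formalDeriv {S : Type} [CommRing S] [Algebra ℝ S] (φ : R →ₗ[ℝ] S) (a : ι)
    (f : Series d R) : mapCoeff φ (formalDeriv a f) = formalDeriv a (mapCoeff φ f) := by
  ext α hα
  simp only [coeff_mapCoeff, coeff_formalDeriv, map_smul]

end Series

/-! ### Hadamard's lemma on a vector space -/

open MeasureTheory in
theorem hasFDerivAt_integral_of_contDiff {E F : Type} [NormedAddCommGroup E] [NormedSpace ℝ E]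
    [FiniteDimensional ℝ E] [NormedAddCommGroup F] [NormedSpace ℝ F] {f : E × ℝ → F}
    (hf : ContDiff ℝ ∞ f) (x₀ : E) :
    HasFDerivAt (fun x => ∫ t in (0 : ℝ)..1, f (x, t))
      (∫ t in (0 : ℝ)..1, (fderiv ℝ f (x₀, t)).comp (ContinuousLinearMap.inl ℝ E ℝ)) x₀ := by
  have hc : Continuous fun z : E × ℝ => (fderiv ℝ f z).comp (ContinuousLinearMap.inl ℝ E ℝ) :=
    (hf.continuous_fderiv (by simp)).clm_comp continuous_const
  -- Compactness of the unit ball times `[0, 1]` gives the constant that dominates the derivative.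
  obtain ⟨B, hB⟩ := ((isCompact_closedBall x₀ 1).prod (isCompact_Icc (a := (0 : ℝ)) (b := 1))
    ).exists_bound_of_continuousOn hc.continuousOn
  have hfc := hf.continuous
  refine (intervalIntegral.hasFDerivAt_integral_of_dominated_of_fderiv_le (μ := volume)
    (F := fun x t => f (x, t))
    (F' := fun x t => (fderiv ℝ f (x, t)).comp (ContinuousLinearMap.inl ℝ E ℝ))
    (bound := fun _ => B) (Metric.closedBall_mem_nhds x₀ one_pos) ?_ ?_ ?_ ?_ ?_ ?_)
  · exact Filter.Eventually.of_forall fun x =>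
      (by fun_prop : Continuous fun t => f (x, t)).aestronglyMeasurable
  · exact (by fun_prop : Continuous fun t => f (x₀, t)).intervalIntegrable _ _
  · exact (hc.comp (by fun_prop : Continuous fun t : ℝ => (x₀, t))).aestronglyMeasurable
  · refine Filter.Eventually.of_forall fun t ht x hx => hB (x, t) ⟨hx, ?_⟩
    rw [Set.uIoc_of_le zero_le_one] at ht
    exact Set.Ioc_subset_Icc_self ht
  · exact intervalIntegrable_const
  · refine Filter.Eventually.of_forall fun t _ x _ => ?_
    have h1 : HasFDerivAt f (fderiv ℝ f (x, t)) (x, t) :=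
      (hf.differentiable (by simp) (x, t)).hasFDerivAt
    exact HasFDerivAt.comp x h1 (hasFDerivAt_prodMk_left x t)

/-- The derivative is an integral of the same kind with values in a space of linear maps, hence the
induction over all target spaces `F`. -/
theorem contDiff_integral {E F : Type} [NormedAddCommGroup E] [NormedSpace ℝ E]
    [FiniteDimensional ℝ E] [NormedAddCommGroup F] [NormedSpace ℝ F] {f : E × ℝ → F}
    (hf : ContDiff ℝ ∞ f) : ContDiff ℝ ∞ fun x => ∫ t in (0 : ℝ)..1, f (x, t) := by
  rw [contDiff_infty]
  intro m
  induction m generalizing F with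
  | zero =>
    rw [Nat.cast_zero, contDiff_zero]
    exact intervalIntegral.continuous_parametric_intervalIntegral_of_continuous'
      (f := fun x t => f (x, t)) hf.continuous 0 1
  | succ m ih =>
    rw [Nat.cast_add, Nat.cast_one, contDiff_succ_iff_hasFDerivAt]
    refine ⟨_, ?_, hasFDerivAt_integral_of_contDiff hf⟩
    exact ih (f := fun z => (fderiv ℝ f z).comp (ContinuousLinearMap.inl ℝ E ℝ))
      ((hf.fderiv_right (by simp)).clm_comp contDiff_const)

/-- Hadamard's lemma. -/
theorem exists_contDiff_apply_sub {E : Type} [NormedAddCommGroup E] [NormedSpace ℝ E]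
    [FiniteDimensional ℝ E] {f : E → ℝ} (hf : ContDiff ℝ ∞ f) (x₀ : E) :
    ∃ L : E → E →L[ℝ] ℝ, ContDiff ℝ ∞ L ∧ ∀ x, f x = f x₀ + L x (x - x₀) := by
  have hf' : ContDiff ℝ ∞ (fderiv ℝ f) := hf.fderiv_right (by simp)
  have hL : ContDiff ℝ ∞ fun z : E × ℝ => fderiv ℝ f (x₀ + z.2 • (z.1 - x₀)) :=
    hf'.comp (by fun_prop)
  -- The derivative averaged along the segment from `x₀` to `x`; the formula is the fundamental
  -- theorem of calculus.
  refine ⟨fun x => ∫ t in (0 : ℝ)..1, fderiv ℝ f (x₀ + t • (x - x₀)), contDiff_integral hL,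
    fun x => ?_⟩
  have hc : Continuous fun t : ℝ => fderiv ℝ f (x₀ + t • (x - x₀)) :=
    hf'.continuous.comp (by fun_prop)
  rw [ContinuousLinearMap.intervalIntegral_apply (hc.intervalIntegrable _ _)]
  have hd : ∀ t ∈ Set.uIcc (0 : ℝ) 1, HasDerivAt (fun t : ℝ => f (x₀ + t • (x - x₀)))
      (fderiv ℝ f (x₀ + t • (x - x₀)) (x - x₀)) t := by
    intro t _
    have h1 : HasFDerivAt f (fderiv ℝ f (x₀ + t • (x - x₀))) (x₀ + t • (x - x₀)) :=
      (hf.differentiable (by simp) _).hasFDerivAt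
    have h2 : HasDerivAt (fun t : ℝ => x₀ + t • (x - x₀)) (x - x₀) t := by
      simpa using ((hasDerivAt_id t).smul_const (x - x₀)).const_add x₀
    exact h1.comp_hasDerivAt t h2
  rw [intervalIntegral.integral_eq_sub_of_hasDerivAt hd
    ((hc.clm_apply continuous_const).intervalIntegrable _ _)]
  simp

/-! ### Smooth functions on open subsets of Euclidean space -/

section Smooth

variable {p : ℕ} {V : Opens (Base p)}

/-- The smooth function on an open subset given by a function that is smooth at its points. -/
def smoothOf (V : Opens (Base p)) (f : Base p → ℝ) (hf : ∀ x ∈ V, ContDiffAt ℝ ∞ f x) : Smooth V :=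
  ⟨fun x => f x, fun x => contMDiffAt_subtype_iff.mpr (hf x x.2).contMDiffAt⟩

@[simp]
theorem smoothOf_apply (f : Base p → ℝ) (hf : ∀ x ∈ V, ContDiffAt ℝ ∞ f x) (x : V) :
    smoothOf V f hf x = f x := rfl

theorem extendZero_eventuallyEq {f : Base p → ℝ} {g : V → ℝ} (h : ∀ x : V, g x = f x) (x : V) :
    extendZero g =ᶠ[nhds (x : Base p)] f := by
  filter_upwards [V.isOpen.mem_nhds x.2] with y hy
  rw [← h ⟨y, hy⟩]
  exact extendZero_coe g ⟨y, hy⟩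

theorem smoothDeriv_apply (i : Fin p) (f : Smooth V) (x : V) :
    smoothDeriv i f x = fderiv ℝ (extendZero f) (x : Base p) (EuclideanSpace.single i 1) := rfl

theorem smoothDeriv_smoothOf (i : Fin p) (f : Base p → ℝ) (hf : ∀ x ∈ V, ContDiffAt ℝ ∞ f x)
    (x : V) : smoothDeriv i (smoothOf V f hf) x =
      fderiv ℝ f (x : Base p) (EuclideanSpace.single i 1) := by
  rw [smoothDeriv_apply, (extendZero_eventuallyEq (smoothOf_apply f hf) x).fderiv_eq]

theorem smoothDeriv_mul (i : Fin p) (f g : Smooth V) :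
    smoothDeriv i (f * g) = smoothDeriv i f * g + f * smoothDeriv i g := by
  ext x
  have e : extendZero (⇑(f * g)) = fun y => extendZero f y * extendZero g y := by
    funext y
    by_cases hy : y ∈ V <;> simp [extendZero, hy]
  change fderiv ℝ (extendZero (⇑(f * g))) (x : Base p) _ =
    fderiv ℝ (extendZero f) (x : Base p) _ * g x + f x * fderiv ℝ (extendZero g) (x : Base p) _
  rw [e, fderiv_fun_mul ((contDiffAt_extendZero f x).differentiableAt (by simp))
    ((contDiffAt_extendZero g x).differentiableAt (by simp))]
  simp [extendZero_coe]
  ring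

theorem smoothDeriv_one (i : Fin p) : smoothDeriv i (1 : Smooth V) = 0 := by
  have := smoothDeriv_mul i (1 : Smooth V) 1
  simpa using this

theorem smoothRes_smoothDeriv {W : Opens (Base p)} (h : W ≤ V) (i : Fin p) (f : Smooth V) :
    smoothRes h (smoothDeriv i f) = smoothDeriv i (smoothRes h f) := by
  ext x
  change fderiv ℝ (extendZero f) (x : Base p) _ = fderiv ℝ (extendZero (smoothRes h f)) x _
  rw [(extendZero_eventuallyEq (f := extendZero f) (fun y => ?_) x).fderiv_eq]
  exact (extendZero_coe f ⟨y, h y.2⟩).symm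

/-- The coordinate functions. -/
def smoothCoord (V : Opens (Base p)) (i : Fin p) : Smooth V :=
  smoothOf V (fun x => x i) fun x _ => by fun_prop

theorem smoothDeriv_smoothCoord (i j : Fin p) :
    smoothDeriv i (smoothCoord V j) = if i = j then 1 else 0 := by
  ext x
  rw [smoothCoord, smoothDeriv_smoothOf]
  have h : HasFDerivAt (fun x : Base p => x j) (EuclideanSpace.proj j : Base p →L[ℝ] ℝ) x :=
    (EuclideanSpace.proj j : Base p →L[ℝ] ℝ).hasFDerivAt
  rw [h.fderiv]
  by_cases hij : i = j
  · subst hij; simp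
  · simp [hij, Ne.symm hij]

theorem smooth_sum_apply {κ : Type*} (s : Finset κ) (c : κ → Smooth V) (x : V) :
    (∑ i ∈ s, c i) x = ∑ i ∈ s, c i x := by
  classical
  induction s using Finset.induction_on with
  | empty => simp
  | insert i s hi ih => rw [Finset.sum_insert hi, Finset.sum_insert hi, ← ih]; rfl

/-- Hadamard's lemma on an arbitrary open subset. -/
theorem exists_eq_add_sum_coord_mul (f : Smooth V) (x₀ : V) :
    ∃ g : Fin p → Smooth V, f = algebraMap ℝ _ (f x₀) +
      ∑ i, (smoothCoord V i - algebraMap ℝ _ ((x₀ : Base p) i)) * g i := by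
  -- As `V` need not be star-shaped, `f - f x₀` is split by a cutoff `ψ`. The part `ψ (f - f x₀)`
  -- extends smoothly to the whole space, where the segment argument works. In the other part `1 -
  -- ψ` vanishes near `x₀` and is divisible by `‖x - x₀‖ ^ 2 = ∑ (x_i - x₀_i) ^ 2`.
  obtain ⟨ε, hε, hball⟩ := Metric.isOpen_iff.1 V.isOpen (x₀ : Base p) x₀.2
  let ψ : ContDiffBump (x₀ : Base p) := ⟨ε / 4, ε / 2, by positivity, by linarith⟩
  have hψ : ContDiff ℝ ∞ ψ := ψ.contDiff
  have hF : ContDiff ℝ ∞ fun x => ψ x * (extendZero f x - f x₀) := by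
    rw [contDiff_iff_contDiffAt]
    intro x
    by_cases hx : x ∈ V
    · exact hψ.contDiffAt.mul ((contDiffAt_extendZero f ⟨x, hx⟩).sub contDiffAt_const)
    · have hx' : x ∉ tsupport ψ := by
        rw [ψ.tsupport_eq]
        exact fun h => hx (hball (Metric.closedBall_subset_ball (by simp [ψ]; linarith) h))
      refine (contDiffAt_const (c := (0 : ℝ))).congr_of_eventuallyEq ?_
      filter_upwards [notMem_tsupport_iff_eventuallyEq.1 hx'] with y hy
      rw [hy]; simp
  have hH : ContDiff ℝ ∞ fun x => (1 - ψ x) / ‖x - x₀‖ ^ 2 := by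
    rw [contDiff_iff_contDiffAt]
    intro x
    by_cases hx : x = x₀
    · subst hx
      refine (contDiffAt_const (c := (0 : ℝ))).congr_of_eventuallyEq ?_
      filter_upwards [ψ.eventuallyEq_one] with y hy
      rw [hy]; simp
    · refine (contDiffAt_const.sub hψ.contDiffAt).div ?_ ?_
      · exact ((contDiff_id.sub contDiff_const).norm_sq ℝ).contDiffAt
      · simpa [sub_eq_zero] using hx
  obtain ⟨L, hL, hFL⟩ := exists_contDiff_apply_sub hF (x₀ : Base p)
  refine ⟨fun i => smoothOf V (fun x => L x (EuclideanSpace.single i 1))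
      (fun x _ => (hL.clm_apply contDiff_const).contDiffAt) +
    (smoothCoord V i - algebraMap ℝ _ ((x₀ : Base p) i)) * smoothOf V _
      (fun x _ => hH.contDiffAt) * (f - algebraMap ℝ _ (f x₀)), ?_⟩
  ext x
  change f x = f x₀ + (∑ i, _ : Smooth V) x
  rw [smooth_sum_apply]
  change f x = f x₀ + ∑ i, ((x : Base p) i - (x₀ : Base p) i) *
    (L x (EuclideanSpace.single i 1) + ((x : Base p) i - (x₀ : Base p) i) *
      ((1 - ψ x) / ‖(x : Base p) - x₀‖ ^ 2) * (f x - f x₀))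
  have h1 := hFL x
  simp only [extendZero_coe, ψ.one_of_mem_closedBall (Metric.mem_closedBall_self (by positivity)),
    sub_self, mul_zero, zero_add] at h1
  have h2 : L x ((x : Base p) - x₀) =
      ∑ i, ((x : Base p) i - (x₀ : Base p) i) * L x (EuclideanSpace.single i 1) := by
    conv_lhs => rw [← (EuclideanSpace.basisFun (Fin p) ℝ).sum_repr ((x : Base p) - x₀)]
    simp [map_sum]
  have h3 : ∑ i, ((x : Base p) i - (x₀ : Base p) i) ^ 2 = ‖(x : Base p) - x₀‖ ^ 2 := by
    simp [EuclideanSpace.real_norm_sq_eq]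
  have h4 : ∑ i, ((x : Base p) i - (x₀ : Base p) i) *
      (L x (EuclideanSpace.single i 1) + ((x : Base p) i - (x₀ : Base p) i) *
      ((1 - ψ x) / ‖(x : Base p) - x₀‖ ^ 2) * (f x - f x₀)) =
      ψ x * (f x - f x₀) + ‖(x : Base p) - x₀‖ ^ 2 *
        (((1 - ψ x) / ‖(x : Base p) - x₀‖ ^ 2) * (f x - f x₀)) := by
    rw [h1, h2, ← h3, Finset.sum_mul, ← Finset.sum_add_distrib]
    exact Finset.sum_congr rfl fun i _ => by ring
  rw [h4]
  -- At `x₀` the quotient has denominator zero, but there both sides reduce to `f x₀`.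
  by_cases hx : (x : Base p) - x₀ = 0
  · have : x = x₀ := Subtype.ext (sub_eq_zero.1 hx)
    rw [this]; simp
  · have hne : ‖(x : Base p) - x₀‖ ^ 2 ≠ 0 := by positivity
    rw [← mul_assoc, mul_div_cancel₀ _ hne]
    ring

end Smooth

/-! ### Rigidity of the domain -/

section Domain

variable {n p : ℕ} {q : {γ : Deg n // γ ≠ 0} → ℕ} {V : Opens (Base p)}

/-- An operator that commutes up to factors with the coordinates and annihilates the unit
vanishes. -/
theorem domain_end_eq_zero {E : Module.End ℝ (DomainSections q V)}
    (hvar : ∀ a, ∃ ε : ℝ, ∀ f, E (Series.var a * f) = ε • (Series.var a * E f))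
    (hcoord : ∀ i f, E (Series.const (smoothCoord V i) * f) =
      Series.const (smoothCoord V i) * E f) (h1 : E 1 = 0) : E = 0 := by
  refine Series.end_eq_zero hvar fun r => ?_
  ext α hα x₀
  -- The expansion depends on the point `x₀` at which the coefficient is evaluated. `E` kills the
  -- number `r x₀` because `E 1 = 0`, and carries each factor `x_i - x₀_i` outside, where it
  -- vanishes at `x₀`.
  obtain ⟨g, hg⟩ := exists_eq_add_sum_coord_mul r x₀
  have hreal : ∀ t : ℝ, (Series.const (algebraMap ℝ (Smooth V) t) : DomainSections q V) =
      t • 1 := fun t => by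
    rw [Algebra.algebraMap_eq_smul_one, Series.const_smul, Series.const_one]
  have hmul : ∀ i, E (Series.const ((smoothCoord V i -
      algebraMap ℝ (Smooth V) ((x₀ : Base p) i)) * g i)) =
      Series.const (smoothCoord V i - algebraMap ℝ (Smooth V) ((x₀ : Base p) i)) *
        E (Series.const (g i)) := by
    intro i
    have : smoothCoord V i - algebraMap ℝ (Smooth V) ((x₀ : Base p) i) =
        smoothCoord V i + (-(x₀ : Base p) i) • 1 := by
      rw [Algebra.algebraMap_eq_smul_one, neg_smul, sub_eq_add_neg]
    rw [this, Series.const_mul, Series.const_add, Series.const_smul, Series.const_one, add_mul,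
      map_add, hcoord, smul_mul_assoc, one_mul, map_smul, add_mul, smul_mul_assoc, one_mul]
  rw [hg, Series.const_add, Series.const_sum, map_add, hreal, map_smul, h1, smul_zero, zero_add,
    map_sum, Series.coeff_sum, Series.coeff_zero]
  rw [smooth_sum_apply]
  refine Finset.sum_eq_zero fun i _ => ?_
  rw [hmul, Series.coeff_const_mul]
  change ((x₀ : Base p) i - (x₀ : Base p) i) * _ = 0
  rw [sub_self, zero_mul]

end Domain

/-! ### The structure sheaf and its grading -/

namespace RingedSpace

variable {n : ℕ} (X : RingedSpace.{u} n)

theorem res_self (U : Opens X.carrier) (f : X.Sec U) : X.res (le_refl U) f = f := by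
  have : (homOfLE (le_refl U)).op = 𝟙 (op U) := rfl
  rw [res, this, X.presheaf.map_id]
  rfl

theorem res_res {U V W : Opens X.carrier} (h : V ≤ U) (h' : W ≤ V) (f : X.Sec U) :
    X.res h' (X.res h f) = X.res (h'.trans h) f := by
  have : (homOfLE (h'.trans h)).op = (homOfLE h).op ≫ (homOfLE h').op := rfl
  rw [res, res, res, this, X.presheaf.map_comp]
  rfl

theorem eq_of_res_eq {U : Opens X.carrier} {s t : X.Sec U}
    (h : ∀ x ∈ U, ∃ (V : Opens X.carrier) (hV : V ≤ U), x ∈ V ∧ X.res hV s = X.res hV t) :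
    s = t := by
  choose V hV hx hst using h
  exact X.sheaf.eq_of_locally_eq' (fun x : U => V x x.2) U (fun x => homOfLE (hV x x.2))
    (fun x hxU => Opens.mem_iSup.2 ⟨⟨x, hxU⟩, hx x hxU⟩) s t fun x => hst x x.2

theorem exists_glue {U : Opens X.carrier} {ι : Type*} (V : ι → Opens X.carrier)
    (hV : ∀ i, V i ≤ U) (hcov : ∀ x ∈ U, ∃ i, x ∈ V i) (s : ∀ i, X.Sec (V i))
    (hs : ∀ i j, X.res (inf_le_left : V i ⊓ V j ≤ V i) (s i) =
      X.res (inf_le_right : V i ⊓ V j ≤ V j) (s j)) :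
    ∃ f : X.Sec U, ∀ i, X.res (hV i) f = s i := by
  obtain ⟨f, hf, -⟩ := X.sheaf.existsUnique_gluing' V U (fun i => homOfLE (hV i))
    (fun x hx => Opens.mem_iSup.2 (hcov x hx)) s hs
  exact ⟨f, hf⟩

theorem res_mem_part {U V : Opens X.carrier} (h : V ≤ U) {γ : Deg n} {f : X.Sec U}
    (hf : f ∈ X.part U γ) : X.res h f ∈ X.part V γ :=
  X.map_mem_part h γ f hf

theorem proj_res {U V : Opens X.carrier} (h : V ≤ U) (γ : Deg n) (f : X.Sec U) :
    GradedAlgebra.proj (X.part V) γ (X.res h f) =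
      X.res h (GradedAlgebra.proj (X.part U) γ f) := by
  induction f using homogeneous_induction (X.part U) with
  | h0 => simp
  | hadd a b ha hb => simp only [map_add, ha, hb]
  | hom δ a ha =>
    rw [proj_of_mem _ ha, proj_of_mem _ (X.res_mem_part h ha)]
    split_ifs <;> simp

/-- Being homogeneous is a local property. -/
theorem mem_part_of_locally {U : Opens X.carrier} {f : X.Sec U} {γ : Deg n}
    (h : ∀ x ∈ U, ∃ (V : Opens X.carrier) (hV : V ≤ U), x ∈ V ∧ X.res hV f ∈ X.part V γ) :
    f ∈ X.part U γ := by
  have : f = GradedAlgebra.proj (X.part U) γ f := by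
    refine X.eq_of_res_eq fun x hx => ?_
    obtain ⟨V, hV, hxV, hf⟩ := h x hx
    exact ⟨V, hV, hxV, by rw [← proj_res, proj_of_mem _ hf, if_pos rfl]⟩
  rw [this]
  exact proj_mem _ γ f

/-! ### Compatible operators -/

variable {X}

/-- The operator `D'` over `V` restricts the operator `D` over `U`. -/
def Restricts {U V : Opens X.carrier} (h : V ≤ U) (D : Module.End ℝ (X.Sec U))
    (D' : Module.End ℝ (X.Sec V)) : Prop :=
  ∀ g, D' (X.res h g) = X.res h (D g)

namespace Restricts

variable {U V W : Opens X.carrier} {h : V ≤ U} {D E : Module.End ℝ (X.Sec U)}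
  {D' E' : Module.End ℝ (X.Sec V)}

theorem trans {h' : W ≤ V} {D'' : Module.End ℝ (X.Sec W)} (hD : Restricts h D D')
    (hD' : Restricts h' D' D'') : Restricts (h'.trans h) D D'' := fun g => by
  rw [← res_res X h h', hD', hD, res_res]

theorem mulLeft (h : V ≤ U) (f : X.Sec U) :
    Restricts h (LinearMap.mulLeft ℝ f) (LinearMap.mulLeft ℝ (X.res h f)) := fun g => by
  simp

theorem smul (hD : Restricts h D D') (f : X.Sec U) : Restricts h (f • D) (X.res h f • D') :=
  fun g => by simp [hD g]

theorem add (hD : Restricts h D D') (hE : Restricts h E E') : Restricts h (D + E) (D' + E') :=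
  fun g => by simp [hD g, hE g]

theorem endComponent (hD : Restricts h D D') (γ : Deg n) :
    Restricts h (endComponent (X.part U) γ D) (endComponent (X.part V) γ D') := fun g => by
  simp only [endComponent_apply, proj_res, hD _, map_sum]

theorem gradedCommutator (hD : Restricts h D D') (hE : Restricts h E E') :
    Restricts h (gradedCommutator (X.part U) D E) (gradedCommutator (X.part V) D' E') := by
  intro g
  simp only [Z2n.gradedCommutator, LinearMap.sum_apply, LinearMap.sub_apply, LinearMap.smul_apply,
    Module.End.mul_apply, map_sum, map_sub, map_smul, (hD.endComponent _) _,
    (hE.endComponent _) _]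

end Restricts

/-- Being a differential operator is a local property. -/
theorem ordLT_of_locally {U : Opens X.carrier} {k : ℕ} {D : Module.End ℝ (X.Sec U)}
    (h : ∀ x ∈ U, ∃ (V : Opens X.carrier) (hV : V ≤ U), x ∈ V ∧
      ∃ D' : Module.End ℝ (X.Sec V), Restricts hV D D' ∧ OrdLT (X.part V) k D') :
    OrdLT (X.part U) k D := by
  induction k generalizing D with
  | zero =>
    refine LinearMap.ext fun g => X.eq_of_res_eq fun x hx => ?_
    obtain ⟨V, hV, hxV, D', hD', h0⟩ := h x hx
    exact ⟨V, hV, hxV, by rw [← hD' g, show D' = 0 from h0]; simp⟩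
  | succ k ih =>
    intro f
    refine ih fun x hx => ?_
    obtain ⟨V, hV, hxV, D', hD', h0⟩ := h x hx
    -- The commutator of `D'` with the restriction of `f` restricts that of `D` with `f`, so the
    -- local hypothesis passes to commutators.
    exact ⟨V, hV, hxV, _, hD'.gradedCommutator (Restricts.mulLeft hV f), h0 _⟩

/-! ### Bump functions -/

variable (X) in
/-- Every point of an open subset has a bump function with support in this open subset. -/
def HasBumps : Prop :=
  ∀ (U : Opens X.carrier), ∀ x ∈ U, ∃ ρ ∈ X.part ⊤ 0, ∃ W C : Opens X.carrier, x ∈ W ∧ W ≤ U ∧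
    U ⊔ C = ⊤ ∧ X.res le_top ρ = (1 : X.Sec W) ∧ X.res le_top ρ = (0 : X.Sec C)

/-- With a bump function `ρ`, the section `ρ f` over `V` and zero over `C` glue to a global section
that equals `f` where `ρ = 1`. The set `W` does not depend on `f`, so several sections can be
extended together. -/
theorem exists_extension (hX : X.HasBumps) (V : Opens X.carrier) {x : X.carrier} (hx : x ∈ V) :
    ∃ (W : Opens X.carrier) (hW : W ≤ V), x ∈ W ∧
      ∀ f : X.Sec V, ∃ F : X.Sec ⊤, X.res le_top F = X.res hW f := by
  obtain ⟨ρ, -, W, C, hxW, hW, hC, h1, h0⟩ := hX V x hx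
  refine ⟨W, hW, hxW, fun f => ?_⟩
  have h0' : ∀ (T : Opens X.carrier), T ≤ C → X.res (le_top : T ≤ ⊤) ρ = 0 := fun T hT => by
    rw [← res_res X le_top hT, h0, map_zero]
  let S : Bool → Opens X.carrier := fun b => if b then V else C
  let s : ∀ b, X.Sec (S b) := fun b => match b with
    | true => X.res le_top ρ * f
    | false => 0
  obtain ⟨F, hF⟩ := X.exists_glue (U := ⊤) S (fun _ => le_top) (fun y hy => by
      rw [← hC] at hy
      rcases hy with hy | hy
      · exact ⟨true, hy⟩
      · exact ⟨false, hy⟩) s (by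
      rintro (_ | _) (_ | _)
      · rfl
      · change X.res _ (0 : X.Sec C) = X.res _ (X.res le_top ρ * f)
        rw [map_zero, map_mul, res_res, h0' _ inf_le_left, zero_mul]
      · change X.res _ (X.res le_top ρ * f) = X.res _ (0 : X.Sec C)
        rw [map_zero, map_mul, res_res, h0' _ inf_le_right, zero_mul]
      · rfl)
  refine ⟨F, ?_⟩
  have hFV : X.res le_top F = X.res le_top ρ * f := hF true
  rw [← res_res X le_top hW, hFV, map_mul, res_res, h1, one_mul]

theorem exists_extension' (hX : X.HasBumps) {U V : Opens X.carrier} (h : V ≤ U) {x : X.carrier}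
    (hx : x ∈ V) : ∃ (W : Opens X.carrier) (hW : W ≤ V), x ∈ W ∧
      ∀ f : X.Sec V, ∃ F : X.Sec U, X.res (hW.trans h) F = X.res hW f := by
  obtain ⟨W, hW, hxW, H⟩ := exists_extension hX V hx
  refine ⟨W, hW, hxW, fun f => ?_⟩
  obtain ⟨F, hF⟩ := H f
  exact ⟨X.res le_top F, by rw [res_res, hF]⟩

/-! ### Locality and restriction of differential operators -/

/-- Operators of bounded order map multiples of high powers of an element of degree zero to
multiples of this element. -/
theorem _root_.Z2n.OrdLT.exists_apply_pow_mul {A : Type*} [Ring A] [Algebra ℝ A]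
    {𝒜 : Deg n → Submodule ℝ A} [GradedAlgebra 𝒜] {σ : A} (hσ : σ ∈ 𝒜 0) {k : ℕ}
    {D : Module.End ℝ A} (hD : OrdLT 𝒜 k D) (f : A) : ∃ g, D (σ ^ k * f) = σ * g := by
  induction k generalizing D f with
  | zero => exact ⟨0, by rw [show D = 0 from hD]; simp⟩
  | succ k ih =>
    -- Since `σ` has degree zero no signs occur, and the graded commutator is the ordinary one. Then
    -- `D (σ^(k+1) f) = [D, σ] (σ^k f) + σ D (σ^k f)`.
    have e : gradedCommutator 𝒜 D (LinearMap.mulLeft ℝ σ) =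
        D * LinearMap.mulLeft ℝ σ - LinearMap.mulLeft ℝ σ * D := by
      rw [gradedCommutator_mulLeft 𝒜 hσ]
      simp only [sgn_zero_right, one_smul, Finset.sum_sub_distrib, ← Finset.sum_mul,
        ← Finset.mul_sum, sum_endComponent]
    obtain ⟨g, hg⟩ := ih (hD σ) f
    rw [e] at hg
    refine ⟨g + D (σ ^ k * f), ?_⟩
    simp only [LinearMap.sub_apply, Module.End.mul_apply, LinearMap.mulLeft_apply] at hg
    rw [pow_succ', mul_assoc, mul_add, ← hg, sub_add_cancel]

/-- Differential operators are local. -/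
theorem res_apply_eq_zero (hX : X.HasBumps) {U V : Opens X.carrier} (h : V ≤ U) {k : ℕ}
    {D : Module.End ℝ (X.Sec U)} (hD : OrdLT (X.part U) k D) {f : X.Sec U}
    (hf : X.res h f = 0) : X.res h (D f) = 0 := by
  refine X.eq_of_res_eq fun x hx => ?_
  obtain ⟨ρ, hρ, W, C, hxW, hW, hC, h1, h0⟩ := hX V x hx
  refine ⟨W, hW, hxW, ?_⟩
  -- `ρ f = 0`, since `f` vanishes on `V`, `ρ` on `C`, and these cover. So `f = σ^k f`, and `D f` is
  -- a multiple of `σ`, which vanishes on the neighbourhood `W` of `x`.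
  let σ : X.Sec U := 1 - X.res le_top ρ
  have hσ : σ ∈ X.part U 0 :=
    Submodule.sub_mem _ (SetLike.one_mem_graded _) (X.map_mem_part _ 0 ρ hρ)
  have hρf : X.res le_top ρ * f = 0 := by
    refine X.eq_of_res_eq fun y hy => ?_
    have hy' : y ∈ V ⊔ C := by rw [hC]; trivial
    rcases hy' with hy' | hy'
    · exact ⟨V, h, hy', by rw [map_mul, hf, mul_zero, map_zero]⟩
    · refine ⟨C ⊓ U, inf_le_right, ⟨hy', hy⟩, ?_⟩
      rw [map_mul, res_res, ← res_res X le_top (inf_le_left : C ⊓ U ≤ C), h0, map_zero, zero_mul,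
        map_zero]
  have hσf : ∀ m : ℕ, σ ^ m * f = f := by
    intro m
    induction m with
    | zero => simp
    | succ m ih => rw [pow_succ, mul_assoc, sub_mul, one_mul, hρf, sub_zero, ih]
  obtain ⟨g, hg⟩ := hD.exists_apply_pow_mul hσ f
  rw [hσf] at hg
  rw [hg, res_res, map_zero, map_mul, map_sub, map_one, res_res, h1, sub_self, zero_mul]

/-- Differential operators which restrict the same operator coincide. -/
theorem Restricts.unique (hX : X.HasBumps) {U V : Opens X.carrier} {h : V ≤ U} {k : ℕ}
    {D : Module.End ℝ (X.Sec U)} {D' D'' : Module.End ℝ (X.Sec V)} (h' : Restricts h D D')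
    (h'' : Restricts h D D'') (hD' : OrdLT (X.part V) k D') (hD'' : OrdLT (X.part V) k D'') :
    D' = D'' := by
  rw [← sub_eq_zero]
  refine LinearMap.ext fun g => X.eq_of_res_eq fun x hx => ?_
  -- Near `x` the section `g` agrees with one coming from `U`, on which both operators are
  -- prescribed; locality of `D' - D''` transfers this to `g`.
  obtain ⟨W, hW, hxW, H⟩ := exists_extension' hX h hx
  obtain ⟨F, hF⟩ := H g
  refine ⟨W, hW, hxW, ?_⟩
  have h1 : X.res hW (g - X.res h F) = 0 := by rw [map_sub, res_res, hF, sub_self]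
  have h2 := res_apply_eq_zero hX hW (hD'.sub hD'') h1
  have h3 : (D' - D'') (X.res h F) = 0 := by rw [LinearMap.sub_apply, h' F, h'' F, sub_self]
  rw [map_sub, h3, sub_zero] at h2
  rw [h2, LinearMap.zero_apply, map_zero]

/-- A family of operators over the open subsets of `U`, compatible with restrictions. -/
structure OpFamily (U : Opens X.carrier) where
  /-- The members of the family. -/
  op : ∀ V, V ≤ U → Module.End ℝ (X.Sec V)
  restricts : ∀ {V W} (h : V ≤ U) (h' : W ≤ V), Restricts h' (op V h) (op W (h'.trans h))

/-- A multiplier over `V` need not come from `U`, but near each point it agrees with the restriction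
of some `F` over `U`. The commutators with the restrictions of `F` form a family of lower order over
`U`, so the induction runs over whole families, and the order is local. -/
theorem OpFamily.ordLT (hX : X.HasBumps) {U : Opens X.carrier} {k : ℕ} (Φ : OpFamily U)
    (hΦ : OrdLT (X.part U) k (Φ.op U le_rfl)) (V : Opens X.carrier) (hV : V ≤ U) :
    OrdLT (X.part V) k (Φ.op V hV) := by
  induction k generalizing Φ V with
  | zero =>
    refine LinearMap.ext fun g => X.eq_of_res_eq fun x hx => ?_
    obtain ⟨W, hW, hxW, H⟩ := exists_extension' hX hV hx
    obtain ⟨F, hF⟩ := H g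
    refine ⟨W, hW, hxW, ?_⟩
    rw [← Φ.restricts hV hW g, ← hF, Φ.restricts le_rfl (hW.trans hV) F,
      show Φ.op U le_rfl = 0 from hΦ]
    simp
  | succ k ih =>
    intro f
    refine ordLT_of_locally fun x hx => ?_
    obtain ⟨W, hW, hxW, H⟩ := exists_extension' hX hV hx
    obtain ⟨F, hF⟩ := H f
    let Ψ : OpFamily U := {
      op := fun T hT => gradedCommutator (X.part T) (Φ.op T hT)
        (LinearMap.mulLeft ℝ (X.res hT F))
      restricts := fun {T S} hT hS => by
        rw [← res_res X hT hS]
        exact (Φ.restricts hT hS).gradedCommutator (Restricts.mulLeft hS _) }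
    have hΨ : OrdLT (X.part U) k (Ψ.op U le_rfl) := hΦ _
    refine ⟨W, hW, hxW, Ψ.op W (hW.trans hV), ?_, ih Ψ hΨ W _⟩
    change Restricts hW _ (gradedCommutator (X.part W) _ (LinearMap.mulLeft ℝ (X.res _ F)))
    rw [hF]
    exact (Φ.restricts hV hW).gradedCommutator (Restricts.mulLeft hW _)

/-- The section `s` is the value on `g` of the restricted operator. It is glued from `D G` for local
extensions `G` of `g`; by locality of `D` the choice of `G` is irrelevant. Demanding the formula for
all extensions makes `s` canonical. -/
theorem existsUnique_res_apply (hX : X.HasBumps) {U : Opens X.carrier} {k : ℕ}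
    {D : Module.End ℝ (X.Sec U)} (hD : OrdLT (X.part U) k D) {V : Opens X.carrier} (hV : V ≤ U)
    (g : X.Sec V) : ∃! s : X.Sec V, ∀ (W : Opens X.carrier) (hW : W ≤ V) (G : X.Sec U),
      X.res (hW.trans hV) G = X.res hW g → X.res hW s = X.res (hW.trans hV) (D G) := by
  choose! W hW hxW H using fun x (hx : x ∈ V) => exists_extension' hX hV hx
  choose G hG using fun x : V => H x x.2 g
  have hloc : ∀ (T : Opens X.carrier) (hT : T ≤ U) (G G' : X.Sec U), X.res hT G = X.res hT G' →
      X.res hT (D G) = X.res hT (D G') := fun T hT G G' hGG' => by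
    rw [← sub_eq_zero, ← map_sub, ← map_sub]
    exact res_apply_eq_zero hX hT hD (by rw [map_sub, hGG', sub_self])
  obtain ⟨s, hs⟩ := X.exists_glue (U := V) (fun x : V => W x) (fun x => hW x x.2)
    (fun x hx => ⟨⟨x, hx⟩, hxW x hx⟩) (fun x => X.res ((hW x x.2).trans hV) (D (G x)))
    (fun x y => by
      rw [res_res, res_res]
      refine hloc _ _ _ _ ?_
      rw [← res_res X ((hW x x.2).trans hV) inf_le_left, hG,
        ← res_res X ((hW y y.2).trans hV) inf_le_right, hG, res_res, res_res])
  refine ⟨s, fun T hT G' hG' => ?_, fun s' hs' => ?_⟩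
  · refine X.eq_of_res_eq fun x hx => ?_
    refine ⟨T ⊓ W x, inf_le_left, ⟨hx, hxW x (hT hx)⟩, ?_⟩
    have h1 := hs ⟨x, hT hx⟩
    rw [res_res, res_res, ← res_res X (hW x (hT hx)) inf_le_right, h1, res_res]
    refine hloc _ _ _ _ ?_
    rw [← res_res X ((hW x (hT hx)).trans hV) inf_le_right, hG ⟨x, hT hx⟩,
      ← res_res X (hT.trans hV) inf_le_left, hG', res_res, res_res]
  · refine X.eq_of_res_eq fun x hx => ⟨W x, hW x hx, hxW x hx, ?_⟩
    rw [hs' _ (hW x hx) (G ⟨x, hx⟩) (hG ⟨x, hx⟩), hs ⟨x, hx⟩]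

/-- The restrictions of a differential operator. -/
theorem exists_opFamily (hX : X.HasBumps) {U : Opens X.carrier} {k : ℕ}
    {D : Module.End ℝ (X.Sec U)} (hD : OrdLT (X.part U) k D) :
    ∃ Φ : OpFamily U, Φ.op U le_rfl = D := by
  choose Φ hΦ hΦ' using fun V (hV : V ≤ U) (g : X.Sec V) => existsUnique_res_apply hX hD hV g
  -- By uniqueness a candidate need only be tested near each point on one extension. Linearity and
  -- compatibility with restrictions follow by adding, scaling or reusing extensions.
  have hext : ∀ V (hV : V ≤ U) (g s : X.Sec V), (∀ x ∈ V, ∃ (W : Opens X.carrier) (hW : W ≤ V),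
      x ∈ W ∧ ∃ G : X.Sec U, X.res (hW.trans hV) G = X.res hW g ∧
        X.res hW s = X.res (hW.trans hV) (D G)) → s = Φ V hV g := by
    intro V hV g s h
    refine X.eq_of_res_eq fun x hx => ?_
    obtain ⟨W, hW, hxW, G, hG, hs⟩ := h x hx
    exact ⟨W, hW, hxW, by rw [hs, hΦ V hV g W hW G hG]⟩
  have hadd : ∀ V (hV : V ≤ U) f g, Φ V hV (f + g) = Φ V hV f + Φ V hV g := by
    refine fun V hV f g => (hext V hV (f + g) _ fun x hx => ?_).symm
    obtain ⟨W, hW, hxW, H⟩ := exists_extension' hX hV hx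
    obtain ⟨F, hF⟩ := H f
    obtain ⟨G, hG⟩ := H g
    refine ⟨W, hW, hxW, F + G, by rw [map_add, map_add, hF, hG], ?_⟩
    rw [map_add, map_add, map_add, hΦ V hV f W hW F hF, hΦ V hV g W hW G hG]
  have hsmul : ∀ V (hV : V ≤ U) (r : ℝ) f, Φ V hV (r • f) = r • Φ V hV f := by
    refine fun V hV r f => (hext V hV (r • f) _ fun x hx => ?_).symm
    obtain ⟨W, hW, hxW, H⟩ := exists_extension' hX hV hx
    obtain ⟨F, hF⟩ := H f
    refine ⟨W, hW, hxW, r • F, by rw [map_smul, map_smul, hF], ?_⟩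
    rw [map_smul, map_smul, map_smul, hΦ V hV f W hW F hF]
  have hres : ∀ V (hV : V ≤ U) W (hW : W ≤ V) g,
      Φ W (hW.trans hV) (X.res hW g) = X.res hW (Φ V hV g) := by
    refine fun V hV W hW g => (hext W (hW.trans hV) (X.res hW g) _ fun x hx => ?_).symm
    obtain ⟨T, hT, hxT, H⟩ := exists_extension' hX (hW.trans hV) hx
    obtain ⟨G, hG⟩ := H (X.res hW g)
    refine ⟨T, hT, hxT, G, hG, ?_⟩
    rw [res_res] at hG ⊢
    exact hΦ V hV g T (hT.trans hW) G hG
  refine ⟨⟨fun V hV => ⟨⟨Φ V hV, hadd V hV⟩, hsmul V hV⟩,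
    fun {V W} hV hW g => hres V hV W hW g⟩, LinearMap.ext fun g => ?_⟩
  change Φ U le_rfl g = D g
  have := hΦ U le_rfl g U le_rfl g rfl
  rwa [res_self, res_self] at this

theorem exists_restricts (hX : X.HasBumps) {U V : Opens X.carrier} (h : V ≤ U) {k : ℕ}
    {D : Module.End ℝ (X.Sec U)} (hD : OrdLT (X.part U) k D) :
    ∃ D' : Module.End ℝ (X.Sec V), Restricts h D D' ∧ OrdLT (X.part V) k D' := by
  obtain ⟨Φ, rfl⟩ := exists_opFamily hX hD
  exact ⟨Φ.op V h, Φ.restricts le_rfl h, Φ.ordLT hX hD V h⟩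

/-- Both `D'` and its component of degree `γ` restrict `D`, so they coincide. -/
theorem Restricts.mem_endHomogeneous (hX : X.HasBumps) {U V : Opens X.carrier} {h : V ≤ U} {k : ℕ}
    {D : Module.End ℝ (X.Sec U)} {D' : Module.End ℝ (X.Sec V)} (hr : Restricts h D D')
    (hD' : OrdLT (X.part V) k D') {γ : Deg n} (hD : D ∈ endHomogeneous (X.part U) γ) :
    D' ∈ endHomogeneous (X.part V) γ := by
  have h1 : Restricts h D (Z2n.endComponent (X.part V) γ D') := by
    have := hr.endComponent γ
    rwa [endComponent_of_mem _ hD, if_pos rfl] at this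
  rw [hr.unique hX h1 hD' (hD'.endComponent γ)]
  exact endComponent_mem _ γ D'

end RingedSpace

/-! ### Bump functions from charts -/

theorem domainRes_const {n p : ℕ} {q : {γ : Deg n // γ ≠ 0} → ℕ} {V W : Opens (Base p)}
    (h : W ≤ V) (f : Smooth V) :
    domainRes q h (Series.const f) = Series.const (smoothRes h f) :=
  Series.mapCoeff_const _ _

namespace RingedSpace

variable {n p : ℕ} {q : {γ : Deg n // γ ≠ 0} → ℕ} {X : RingedSpace.{u} n}

/-- A Euclidean bump function is pulled back through a chart as a series with a constant term only,
hence of degree zero, and extended by zero. -/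
theorem IsManifold.hasBumps (hX : X.IsManifold p q) : X.HasBumps := by
  intro U x hxU
  obtain ⟨c, hxc⟩ := hX.exists_chart x
  have := hX.t2
  have hV : ((U ⊓ c.source : Opens X.carrier) : Set X.carrier) ⊆ c.φ.source := fun y hy => hy.2
  set V : Opens X.carrier := U ⊓ c.source with hVdef
  set O : Opens (Base p) := imageOpens c.φ V hV with hO
  have hxO : c.φ x ∈ O := ⟨x, ⟨hxU, hxc⟩, rfl⟩
  have hOV : ∀ z ∈ c.φ.source, c.φ z ∈ O → z ∈ V := by
    rintro z hz ⟨w, hw, hwz⟩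
    rwa [← c.φ.injOn (hV hw) hz hwz]
  obtain ⟨ε, hε, hball⟩ := Metric.isOpen_iff.1 O.isOpen _ hxO
  let ψ : ContDiffBump (c.φ x) := ⟨ε / 4, ε / 2, by positivity, by linarith⟩
  have hcb : Metric.closedBall (c.φ x) (ε / 2) ⊆ O :=
    (Metric.closedBall_subset_ball (by linarith)).trans hball
  have hOt : (O : Set (Base p)) ⊆ c.φ.target := by
    rintro _ ⟨w, hw, rfl⟩
    exact c.φ.map_source (hV hw)
  -- The pulled-back ball is compact, hence closed in the Hausdorff space `X`; its complement is the
  -- open set on which the bump function is set to zero.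
  have hK : IsCompact (c.φ.symm '' Metric.closedBall (c.φ x) (ε / 2)) :=
    (isCompact_closedBall _ _).image_of_continuousOn
      (c.φ.symm.continuousOn.mono (hcb.trans hOt))
  have hKV : c.φ.symm '' Metric.closedBall (c.φ x) (ε / 2) ⊆ V := by
    rintro _ ⟨y, hy, rfl⟩
    refine hOV _ (c.φ.map_target (hOt (hcb hy))) ?_
    rw [c.φ.right_inv (hOt (hcb hy))]
    exact hcb hy
  let C : Opens X.carrier := ⟨_, hK.isClosed.isOpen_compl⟩
  let W : Opens X.carrier := ⟨_, c.φ.isOpen_inter_preimage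
    (Metric.isOpen_ball (x := c.φ x) (ε := ε / 4))⟩
  have hWV : W ≤ V := fun z hz => hOV z hz.1 (hball (Metric.ball_subset_ball (by linarith) hz.2))
  have hcov : ∀ z, z ∈ V ∨ z ∈ C := fun z => by
    by_cases hz : z ∈ V
    · exact Or.inl hz
    · exact Or.inr fun h => hz (hKV h)
  let b : Smooth O := smoothOf O ψ fun _ _ => ψ.contDiff.contDiffAt
  let s₀ : X.Sec V := (c.equiv V hV).symm (Series.const b)
  have hs₀ : ∀ (T : Opens X.carrier) (hT : T ≤ V),
      c.equiv T (Set.Subset.trans hT hV) (X.res hT s₀) =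
      Series.const (smoothRes (imageOpens_mono hV hT) b) := fun T hT => by
    rw [c.equiv_res hV hT, AlgEquiv.apply_symm_apply, domainRes_const]
  have hzero : ∀ (T : Opens X.carrier) (hT : T ≤ V), T ≤ C → X.res hT s₀ = 0 := fun T hT hTC => by
    apply (c.equiv T (Set.Subset.trans hT hV)).injective
    rw [hs₀, map_zero]
    have : smoothRes (imageOpens_mono hV hT) b = 0 := by
      ext y
      obtain ⟨y, z, hz, rfl⟩ := y
      change ψ (c.φ z) = 0
      refine ψ.zero_of_le_dist (le_of_not_gt fun hd => hTC hz ?_)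
      exact ⟨c.φ z, Metric.mem_closedBall.2 hd.le, c.φ.left_inv (hV (hT hz))⟩
    rw [this]
    ext α hα
    simp [Series.coeff_const, Series.coeff_zero]
  let S : Bool → Opens X.carrier := fun b => if b then V else C
  let s : ∀ b, X.Sec (S b) := fun b => match b with
    | true => s₀
    | false => 0
  obtain ⟨ρ, hρ⟩ := X.exists_glue (U := ⊤) S (fun _ => le_top)
    (fun z _ => (hcov z).elim (fun h => ⟨true, h⟩) fun h => ⟨false, h⟩) s (by
      rintro (_ | _) (_ | _)
      · rfl
      · change X.res _ (0 : X.Sec C) = X.res _ s₀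
        rw [map_zero, hzero _ _ inf_le_left]
      · change X.res _ s₀ = X.res _ (0 : X.Sec C)
        rw [map_zero, hzero _ _ inf_le_right]
      · rfl)
  have hρV : X.res (le_top : V ≤ ⊤) ρ = s₀ := hρ true
  have hρC : X.res (le_top : C ≤ ⊤) ρ = 0 := hρ false
  refine ⟨ρ, X.mem_part_of_locally fun z _ => ?_, W, C, ⟨hxc, ?_⟩, hWV.trans inf_le_left, ?_, ?_,
    hρC⟩
  · rcases hcov z with h | h
    · refine ⟨V, le_top, h, ?_⟩
      rw [hρV, ← c.equiv_mem_homogeneous V hV, AlgEquiv.apply_symm_apply]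
      exact Series.const_mem b
    · exact ⟨C, le_top, h, by rw [hρC]; exact Submodule.zero_mem _⟩
  · exact Metric.mem_ball_self (by positivity)
  · rw [eq_top_iff]
    exact fun z _ => (hcov z).imp (fun h => h.1) id
  · apply (c.equiv W (Set.Subset.trans hWV hV)).injective
    rw [← res_res X le_top hWV, hρV, hs₀, map_one, ← Series.const_one]
    congr 1
    ext y
    obtain ⟨y, z, hz, rfl⟩ := y
    exact ψ.one_of_mem_closedBall (Metric.ball_subset_closedBall hz.2)

/-! ### The presheaf of differential operators -/

variable {k : ℕ}

theorem ordLT_of_diffOp {U : Opens X.carrier} (D : X.diffOp k U) :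
    OrdLT (X.part U) (k + 1) D.1 :=
  (isDiffOp_iff_ordLT _ k _).1 D.2

theorem mem_diffOp {U : Opens X.carrier} {D : Module.End ℝ (X.Sec U)}
    (h : OrdLT (X.part U) (k + 1) D) : D ∈ X.diffOp k U :=
  (isDiffOp_iff_ordLT _ k _).2 h

theorem eq_of_restricts (hX : X.HasBumps) {U V : Opens X.carrier} {h : V ≤ U}
    {D : Module.End ℝ (X.Sec U)} {D' D'' : X.diffOp k V} (h' : Restricts h D D'.1)
    (h'' : Restricts h D D''.1) : D' = D'' :=
  Subtype.ext (h'.unique hX h'' (ordLT_of_diffOp D') (ordLT_of_diffOp D''))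

/-- The restriction of a differential operator. -/
def diffOpRes (hX : X.HasBumps) {U V : Opens X.carrier} (h : V ≤ U) (D : X.diffOp k U) :
    X.diffOp k V :=
  ⟨(exists_restricts hX h (ordLT_of_diffOp D)).choose,
    mem_diffOp (exists_restricts hX h (ordLT_of_diffOp D)).choose_spec.2⟩

theorem restricts_diffOpRes (hX : X.HasBumps) {U V : Opens X.carrier} (h : V ≤ U)
    (D : X.diffOp k U) : Restricts h D.1 (diffOpRes hX h D).1 :=
  (exists_restricts hX h (ordLT_of_diffOp D)).choose_spec.1

theorem diffOpRes_eq (hX : X.HasBumps) {U V : Opens X.carrier} {h : V ≤ U} {D : X.diffOp k U}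
    {D' : X.diffOp k V} (h' : Restricts h D.1 D'.1) : diffOpRes hX h D = D' :=
  eq_of_restricts hX (restricts_diffOpRes hX h D) h'

/-- The presheaf of differential operators of order `k`. -/
def diffOpPresheaf (hX : X.HasBumps) (k : ℕ) : X.DiffOpPresheaf k where
  res h := AddMonoidHom.mk' (diffOpRes hX h) fun D E => diffOpRes_eq hX
    ((restricts_diffOpRes hX h D).add (restricts_diffOpRes hX h E))
  res_apply h D g := restricts_diffOpRes hX h D g
  res_smul h f D := diffOpRes_eq hX ((restricts_diffOpRes hX h D).smul f)
  res_mem_part h _ D hD :=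
    (restricts_diffOpRes hX h D).mem_endHomogeneous hX (ordLT_of_diffOp _) hD
  res_self U D := diffOpRes_eq hX fun g => by rw [X.res_self, X.res_self]
  res_res h h' D := (diffOpRes_eq hX
    ((restricts_diffOpRes hX h D).trans (restricts_diffOpRes hX h' _))).symm

namespace DiffOpPresheaf

theorem restricts (F : X.DiffOpPresheaf k) {U V : Opens X.carrier} (h : V ≤ U)
    (D : X.diffOp k U) : Restricts h D.1 (F.res h D).1 :=
  F.res_apply h D

/-- The only data are the restriction maps, and their values are forced by uniqueness of restricted
operators. -/
theorem eq (hX : X.HasBumps) (F F' : X.DiffOpPresheaf k) : F = F' := by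
  have h : @F.res = @F'.res := by
    funext U V h
    exact AddMonoidHom.ext fun D => eq_of_restricts hX (F.restricts h D) (F'.restricts h D)
  cases F
  cases F'
  simp only at h
  subst h
  rfl

/-- The value of the glued operator on `g` is glued from the values of the `D i` on the restrictions
of `g`. Its order is bounded because this can be tested on the `U i`. -/
theorem exists_glue (F : X.DiffOpPresheaf k) {ι : Type*} (U : ι → Opens X.carrier)
    (D : ∀ i, X.diffOp k (U i))
    (hD : ∀ i j, F.res (inf_le_left : U i ⊓ U j ≤ U i) (D i) = F.res inf_le_right (D j)) :
    ∃ E : X.diffOp k (iSup U), ∀ i, Restricts (le_iSup U i) E.1 (D i).1 := by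
  have hglue : ∀ g : X.Sec (iSup U), ∃ f : X.Sec (iSup U), ∀ i,
      X.res (le_iSup U i) f = (D i).1 (X.res (le_iSup U i) g) := by
    intro g
    refine X.exists_glue U (le_iSup U) (fun x hx => Opens.mem_iSup.1 hx) _ fun i j => ?_
    rw [← F.res_apply, ← F.res_apply, hD, X.res_res, X.res_res]
  choose E hE using hglue
  have hext : ∀ f g : X.Sec (iSup U),
      (∀ i, X.res (le_iSup U i) f = X.res (le_iSup U i) g) → f = g := by
    refine fun f g h => X.eq_of_res_eq fun x hx => ?_
    obtain ⟨i, hi⟩ := Opens.mem_iSup.1 hx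
    exact ⟨U i, le_iSup U i, hi, h i⟩
  let E' : Module.End ℝ (X.Sec (iSup U)) :=
    { toFun := E
      map_add' := fun f g => hext _ _ fun i => by
        rw [hE, map_add, map_add, map_add, hE, hE]
      map_smul' := fun r f => hext _ _ fun i => by
        rw [hE, map_smul, map_smul, RingHom.id_apply, map_smul, hE] }
  have hE' : ∀ i, Restricts (le_iSup U i) E' (D i).1 := fun i g => (hE g i).symm
  refine ⟨⟨E', mem_diffOp (ordLT_of_locally fun x hx => ?_)⟩, hE'⟩
  obtain ⟨i, hi⟩ := Opens.mem_iSup.1 hx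
  exact ⟨U i, le_iSup U i, hi, (D i).1, hE' i, ordLT_of_diffOp (D i)⟩

theorem isSheaf (hX : X.HasBumps) (F : X.DiffOpPresheaf k) : F.toPresheaf.IsSheaf := by
  -- The sheaf condition is tested on underlying sets, where it is unique gluing.
  rw [TopCat.Presheaf.isSheaf_iff_isSheaf_comp (forget AddCommGrpCat.{u})]
  refine TopCat.Presheaf.isSheaf_of_isSheafUniqueGluing_types _ fun ι U D hD => ?_
  obtain ⟨E, hE⟩ := F.exists_glue U D hD
  refine ⟨E, fun i => eq_of_restricts hX (F.restricts _ E) (hE i), fun E' hE' => ?_⟩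
  refine Subtype.ext (LinearMap.ext fun g => X.eq_of_res_eq fun x hx => ?_)
  obtain ⟨i, hi⟩ := Opens.mem_iSup.1 hx
  refine ⟨U i, le_iSup U i, hi, ?_⟩
  have h1 : F.res (le_iSup U i) E' = D i := hE' i
  rw [← hE i g, ← h1]
  exact (F.restricts (le_iSup U i) E' g).symm

end DiffOpPresheaf

end RingedSpace

/-! ### Coordinate operators of a chart -/

/-- Operators are transported along an isomorphism of algebras. -/
def conjEnd {A B : Type*} [Ring A] [Algebra ℝ A] [Ring B] [Algebra ℝ B] (ε : A ≃ₐ[ℝ] B) :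
    Module.End ℝ B →* Module.End ℝ A where
  toFun D := ε.symm.toLinearMap ∘ₗ D ∘ₗ ε.toLinearMap
  map_one' := by ext; simp
  map_mul' D E := by ext; simp

theorem conjEnd_apply {A B : Type*} [Ring A] [Algebra ℝ A] [Ring B] [Algebra ℝ B] (ε : A ≃ₐ[ℝ] B)
    (D : Module.End ℝ B) (f : A) : conjEnd ε D f = ε.symm (D (ε f)) := rfl

theorem sum_map_eq_sum {ι M : Type*} [Fintype ι] [AddCommMonoid M] {L : List ι} (hL : L.Nodup)
    (hL' : ∀ a, a ∈ L) (f : ι → M) : (L.map f).sum = ∑ a, f a := by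
  classical
  rw [← List.sum_toFinset f hL]
  exact Finset.sum_congr (Finset.eq_univ_iff_forall.2 fun a => List.mem_toFinset.2 (hL' a))
    fun _ _ => rfl

section Domain

variable {n p k : ℕ} {q : {γ : Deg n // γ ≠ 0} → ℕ}

/-- All coordinates of the domain `ℝ^{p|q}`. -/
abbrev CoordVar (p : ℕ) (q : {γ : Deg n // γ ≠ 0} → ℕ) : Type := Fin p ⊕ FormalVar q

/-- The degrees of the coordinates. -/
def coordDeg : CoordVar p q → Deg n := Sum.elim (fun _ => 0) FormalVar.deg

/-- The coordinates in increasing order. -/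
def coordList (p : ℕ) (q : {γ : Deg n // γ ≠ 0} → ℕ) : List (CoordVar p q) :=
  (List.finRange p).map Sum.inl ++
    ((Finset.univ : Finset (FormalVar q)).sort (· ≥ ·)).reverse.map Sum.inr

theorem nodup_coordList : (coordList p q).Nodup := by
  refine List.Nodup.append ((List.nodup_finRange p).map Sum.inl_injective)
    ((List.nodup_reverse.2 (Finset.sort_nodup _ _)).map Sum.inr_injective) ?_
  intro a ha hb
  obtain ⟨i, -, rfl⟩ := List.mem_map.1 ha
  obtain ⟨j, -, h⟩ := List.mem_map.1 hb
  cases h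

theorem mem_coordList (a : CoordVar p q) : a ∈ coordList p q := by
  rcases a with i | a
  · exact List.mem_append_left _ (List.mem_map.2 ⟨i, List.mem_finRange i, rfl⟩)
  · refine List.mem_append_right _ (List.mem_map.2 ⟨a, List.mem_reverse.2 ?_, rfl⟩)
    exact (Finset.mem_sort _).2 (Finset.mem_univ a)

/-- The exponents of all coordinates. -/
def DerivIdx.exponent (i : DerivIdx p q k) : CoordVar p q → ℕ := Sum.elim i.1.1 i.1.2.1

theorem DerivIdx.exponent_injective :
    Function.Injective (DerivIdx.exponent (p := p) (q := q) (k := k)) := by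
  rintro ⟨⟨α, β⟩, hi⟩ ⟨⟨α', β'⟩, hi'⟩ h
  have h1 : α = α' := funext fun c => congrFun h (Sum.inl c)
  have h2 : β = β' := Subtype.ext (Finsupp.ext fun a => congrFun h (Sum.inr a))
  subst h1 h2
  rfl

theorem DerivIdx.exists_exponent_eq_iff (j : CoordVar p q → ℕ) :
    (∃ i : DerivIdx p q k, i.exponent = j) ↔
      (∀ a, IsOdd (coordDeg a) → j a ≤ 1) ∧ ∑ a, j a ≤ k := by
  constructor
  · rintro ⟨⟨⟨α, β⟩, hi⟩, rfl⟩
    refine ⟨?_, ?_⟩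
    · rintro (c | a) ha
      · simp [coordDeg, IsOdd, parity] at ha
      · exact β.2 a ha
    · rw [Fintype.sum_sum_type]
      exact hi
  · rintro ⟨h1, h2⟩
    rw [Fintype.sum_sum_type] at h2
    refine ⟨⟨⟨fun c => j (Sum.inl c), ⟨Finsupp.equivFunOnFinite.symm fun a => j (Sum.inr a),
      fun a ha => h1 (Sum.inr a) ha⟩⟩, h2⟩, ?_⟩
    funext a
    rcases a with c | a <;> rfl

instance : Finite (DerivIdx p q k) := by
  have hle : ∀ (i : DerivIdx p q k) a, i.exponent a < k + 1 := fun i a => by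
    have := ((DerivIdx.exists_exponent_eq_iff (k := k) _).1 ⟨i, rfl⟩).2
    exact Nat.lt_succ_of_le
      ((Finset.single_le_sum (fun _ _ => Nat.zero_le _) (Finset.mem_univ a)).trans this)
  refine Finite.of_injective
    (fun i : DerivIdx p q k => fun a => (⟨i.exponent a, hle i a⟩ : Fin (k + 1))) fun i i' h => ?_
  refine DerivIdx.exponent_injective (funext fun a => ?_)
  exact congrArg Fin.val (congrFun h a)

theorem DerivIdx.deg_eq (i : DerivIdx p q k) :
    i.deg = ∑ a, i.exponent a • (coordDeg a : Deg n) := by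
  rw [Fintype.sum_sum_type]
  simp [DerivIdx.exponent, coordDeg, DerivIdx.deg, monDeg]

theorem domainRes_domainDeriv {V W : Opens (Base p)} (h : W ≤ V) (i : DerivIdx p q k)
    (f : DomainSections q V) :
    domainRes q h (domainDeriv V i f) = domainDeriv W i (domainRes q h f) := by
  have key : ∀ {ι : Type} (L : List ι) (D : ι → Module.End ℝ (DomainSections q V))
      (E : ι → Module.End ℝ (DomainSections q W)) (m : ι → ℕ),
      (∀ a f, domainRes q h (D a f) = E a (domainRes q h f)) → ∀ f,
      domainRes q h ((L.map fun a => D a ^ m a).prod f) =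
        (L.map fun a => E a ^ m a).prod (domainRes q h f) := by
    intro ι L D E m hDE
    have hpow : ∀ a (m : ℕ) f, domainRes q h ((D a ^ m) f) = (E a ^ m) (domainRes q h f) := by
      intro a m
      induction m with
      | zero => intro f; rfl
      | succ m ih => intro f; rw [pow_succ, pow_succ, Module.End.mul_apply, ih, hDE]; rfl
    induction L with
    | nil => intro f; rfl
    | cons a L ih =>
      intro f
      simp only [List.map_cons, List.prod_cons, Module.End.mul_apply]
      rw [hpow, ih]
  rw [domainDeriv, domainDeriv, Module.End.mul_apply, Module.End.mul_apply, key, key]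
  · intro c f
    refine Series.ext fun α _ => ?_
    simp only [domainRes, Series.coeff_mapCoeff, smoothRes_smoothDeriv]
  · exact fun a f => Series.mapCoeff_formalDeriv _ a f

end Domain

namespace RingedSpace

variable {n p k : ℕ} {q : {γ : Deg n // γ ≠ 0} → ℕ} {X : RingedSpace.{u} n}

namespace Chart

variable (c : X.Chart p q) {W : Opens X.carrier} (hW : W ≤ c.source)

/-- The coordinates of a chart over an open subset of its domain. -/
def gradedCoordinates : GradedCoordinates (X.part W) (coordDeg (p := p) (q := q)) where
  X := fun a => (c.equiv W hW).symm
    (Sum.elim (fun i => Series.const (smoothCoord _ i)) Series.var a)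
  P := fun a => conjEnd (c.equiv W hW)
    (Sum.elim (fun i => Series.mapCoeff (smoothDeriv i)) Series.formalDeriv a)
  X_mem := fun a => by
    rw [← c.equiv_mem_homogeneous W hW, AlgEquiv.apply_symm_apply]
    rcases a with i | a
    · exact Series.const_mem _
    · exact Series.var_mem a
  P_mem := fun a δ f hf => by
    rw [← c.equiv_mem_homogeneous W hW] at hf ⊢
    rw [conjEnd_apply, AlgEquiv.apply_symm_apply]
    rcases a with i | a
    · change _ ∈ Series.homogeneous (δ + 0)
      rw [add_zero]
      exact Series.mapCoeff_mem _ hf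
    · exact Series.formalDeriv_mem a hf
  leibniz := fun a φ f hf g => by
    rw [← c.equiv_mem_homogeneous W hW] at hf
    apply (c.equiv W hW).injective
    simp only [conjEnd_apply, map_add, map_mul, map_smul, AlgEquiv.apply_symm_apply]
    rcases a with i | a
    · change Series.mapCoeff _ _ = _ + sgn 0 φ • _
      rw [sgn_zero_left, one_smul]
      exact Series.mapCoeff_leibniz (smoothDeriv_mul i) _ _
    · exact Series.formalDeriv_leibniz a hf _
  P_X := fun a b => by
    apply (c.equiv W hW).injective
    rw [conjEnd_apply, AlgEquiv.apply_symm_apply, AlgEquiv.apply_symm_apply,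
      apply_ite (c.equiv W hW), map_one, map_zero]
    rcases a with i | a <;> rcases b with j | b
    · simp only [Sum.elim_inl, Sum.inl.injEq]
      rw [Series.mapCoeff_const, smoothDeriv_smoothCoord]
      split_ifs
      · exact Series.const_one
      · refine Series.ext fun α _ => ?_
        simp [Series.coeff_const, Series.coeff_zero]
    · simpa using Series.mapCoeff_var (smoothDeriv_one i) b
    · simpa using Series.formalDeriv_const a (smoothCoord _ j)
    · simpa using Series.formalDeriv_var a b
  rigid := fun γ E _ hE h1 => by
    -- The operator is moved to the domain, where rigidity is known. Its commutation with the `x_i`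
    -- carries no sign, as these have degree zero.
    have h : conjEnd (c.equiv W hW).symm E = 0 := by
      have hE' : ∀ a f, conjEnd (c.equiv W hW).symm E
          (Sum.elim (fun i => Series.const (smoothCoord _ i)) Series.var a * f) =
          sgn γ (coordDeg a) •
            (Sum.elim (fun i => Series.const (smoothCoord _ i)) Series.var a *
              conjEnd (c.equiv W hW).symm E f) := by
        intro a f
        simp only [conjEnd_apply, AlgEquiv.symm_symm]
        rw [map_mul, hE, map_smul, map_mul, AlgEquiv.apply_symm_apply]
      refine domain_end_eq_zero (fun a => ⟨_, hE' (Sum.inr a)⟩) (fun i f => ?_) ?_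
      · have := hE' (Sum.inl i) f
        change _ = sgn γ 0 • _ at this
        rwa [sgn_zero_right, one_smul] at this
      · rw [conjEnd_apply, map_one, h1, map_zero]
    ext f
    have := LinearMap.congr_fun h (c.equiv W hW f)
    rw [conjEnd_apply, AlgEquiv.symm_symm, AlgEquiv.symm_apply_apply] at this
    exact (c.equiv W hW).injective (by rw [this]; simp)

/-- `coordList` contains the formal coordinates as the reversed decreasing list, so its own reversal
reproduces literally the order of composition in `domainDeriv`. -/
theorem deriv_eq_diff (i : DerivIdx p q k) :
    c.deriv W hW i = (c.gradedCoordinates hW).diff (coordList p q) i.exponent := by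
  change conjEnd (c.equiv W hW) (domainDeriv _ i) = _
  simp only [domainDeriv, GradedCoordinates.diff, coordList, List.reverse_append, List.map_append,
    List.prod_append, map_mul, map_list_prod, List.map_map, List.map_reverse, List.reverse_reverse]
  congr 3
  · refine funext fun a => ?_
    simp only [Function.comp_apply, map_pow]
    rfl
  · refine List.map_congr_left fun a _ => ?_
    simp only [Function.comp_apply, map_pow]
    rfl

theorem ordLT_deriv (i : DerivIdx p q k) : OrdLT (X.part W) (k + 1) (c.deriv W hW i) := by
  rw [deriv_eq_diff]
  refine ((c.gradedCoordinates hW).ordLT_diff (X.graded_comm W) _ _).1.mono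
    (Nat.succ_le_succ ?_)
  rw [sum_map_eq_sum nodup_coordList mem_coordList]
  exact ((DerivIdx.exists_exponent_eq_iff _).1 ⟨i, rfl⟩).2

theorem deriv_mem_endHomogeneous (i : DerivIdx p q k) :
    c.deriv W hW i ∈ endHomogeneous (X.part W) i.deg := by
  rw [deriv_eq_diff, DerivIdx.deg_eq, ← sum_map_eq_sum nodup_coordList mem_coordList]
  exact ((c.gradedCoordinates hW).ordLT_diff (X.graded_comm W) _ _).2

theorem restricts_deriv (i : DerivIdx p q k) :
    Restricts hW (c.deriv c.source le_rfl i) (c.deriv W hW i) := by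
  intro g
  apply (c.equiv W hW).injective
  simp only [deriv, LinearMap.comp_apply, AlgEquiv.toLinearMap_apply]
  rw [AlgEquiv.apply_symm_apply, c.equiv_res (W := c.source) subset_rfl hW,
    c.equiv_res (W := c.source) subset_rfl hW, AlgEquiv.apply_symm_apply, domainRes_domainDeriv]

/-- The coordinate operators of a chart. -/
def derivDiffOp (i : DerivIdx p q k) : X.diffOp k c.source :=
  ⟨c.deriv c.source le_rfl i, mem_diffOp (c.ordLT_deriv le_rfl i)⟩

/-- Both sides are differential operators that restrict the coordinate operator of the whole chart
domain, so uniqueness applies. -/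
theorem res_derivDiffOp (hX : X.HasBumps) (F : X.DiffOpPresheaf k) (i : DerivIdx p q k) :
    (F.res hW (c.derivDiffOp i) : Module.End ℝ (X.Sec W)) = c.deriv W hW i :=
  (F.restricts hW (c.derivDiffOp i)).unique hX (c.restricts_deriv hW i) (ordLT_of_diffOp _)
    (c.ordLT_deriv hW i)

/-- The coordinates of the chart satisfy the hypotheses of the basis theorem over every open `W` in
its domain, and the restricted operators are the products of derivatives over `W`. -/
theorem isLocalBasis (hX : X.HasBumps) (F : X.DiffOpPresheaf k) :
    F.IsLocalBasis c.source DerivIdx.deg c.derivDiffOp := by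
  refine ⟨fun i => c.deriv_mem_endHomogeneous le_rfl i, fun W hW => ?_⟩
  have := Fintype.ofFinite (DerivIdx p q k)
  exact (c.gradedCoordinates hW).exists_basis (X.graded_comm W) nodup_coordList mem_coordList
    DerivIdx.exponent_injective DerivIdx.exists_exponent_eq_iff
    (fun i => F.res hW (c.derivDiffOp i)) fun i => by rw [c.res_derivDiffOp hW hX F i, deriv_eq_diff]

end Chart

theorem isGradedDiffOp (k : ℕ) (U : Opens X.carrier) : X.IsGradedDiffOp k U where
  isInternal := isInternal_diffOp (X.graded_comm U) k
  smul_mem γ δ f hf D hD := by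
    intro ε a ha
    have := SetLike.mul_mem_graded hf (hD ε a ha)
    rwa [add_left_comm] at this

end RingedSpace

end Z2n

end

theorem theorem4p5 {n p : ℕ} (q : {γ : Z2n.Deg n // γ ≠ 0} → ℕ) (X : Z2n.RingedSpace.{u} n)
    (hX : X.IsManifold p q) (k : ℕ) :
    -- the differential operators over any open subset form a graded module
    (∀ U, X.IsGradedDiffOp k U) ∧
    -- there is exactly one presheaf structure for which restriction of operators is compatible
    -- with restriction of functions
    ∃ F : X.DiffOpPresheaf k, (∀ F' : X.DiffOpPresheaf k, F' = F) ∧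
      -- it is a sheaf
      F.toPresheaf.IsSheaf ∧
      -- it is locally free
      F.IsLocallyFree ∧
      -- the coordinate operators of any chart, over any open subset of its domain, form a basis
      ∀ c : X.Chart p q, ∃ e : Z2n.DerivIdx p q k → X.diffOp k c.source,
        (∀ W (h : W ≤ c.source) i, (F.res h (e i) : Module.End ℝ (X.Sec W)) = c.deriv W h i) ∧
        F.IsLocalBasis c.source Z2n.DerivIdx.deg e := by
  have hb := hX.hasBumps
  let F := Z2n.RingedSpace.diffOpPresheaf hb k
  refine ⟨Z2n.RingedSpace.isGradedDiffOp k, F, fun F' => F'.eq hb F, F.isSheaf hb, fun x => ?_,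
    fun c => ⟨c.derivDiffOp, fun W h i => c.res_derivDiffOp h hb F i, c.isLocalBasis hb F⟩⟩
  obtain ⟨c, hc⟩ := hX.exists_chart x
  exact ⟨c.source, hc, Z2n.DerivIdx p q k, inferInstance, _, _, c.isLocalBasis hb F⟩
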